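/- **Setting.** Let $\mathcal{L}$ be a countable single-sorted language for metric structures: function and relation symbols with arities and moduli of continuity, each relation symbol $B$ taking values in a compact interval $[\lambda_B,\mu_B]\subset\mathbb{R}$, together with a symbol for the metric. An $\mathcal{L}$-structure is a complete metric space with metric bounded by $1$, with interpretations of the symbols that respect the moduli for the supremum metric on tuples. A map $T:E\to F$ between structures is a *morphism* if $\varphi(T\bar a)\le\varphi(\bar a)$, and an *embedding* if $\varphi(T\bar a)=\varphi(\bar a)$, for all atomic formulas $\varphi$ and finite tuples $\bar a$ in $E$. Put $I(T)=\sup_{\varphi,\bar a}|\varphi(\bar a)-\varphi(T\bar a)|$ and $d(S,T)=\sup_x d(Sx,Tx)$; for tuples, $d(\bar a,\bar b)=\max_i d(a_i,b_i)$. The Gromov–Hausdorff distance of $X,Y$ is the infimum of the $\varepsilon>0$ for which there are morphisms $f:X\to Y$, $g:Y\to X$ with $d(gf,\mathrm{id}_X),\,d(fg,\mathrm{id}_Y),\,I(f),\,I(g)<\varepsilon$. Let $\mathcal{A}$ be a class of $\mathcal{L}$-structures, regarded as a category with all morphisms. For a finite tuple $\bar a$ in a structure $E$, $\langle\bar a\rangle\subset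 E$ is the set of $b\in E$ such that $f(b)=g(b)$ whenever $F\in\mathcal{A}$ and $f,g:E\to F$ are morphisms with $f(\bar a)=g(\bar a)$; it is a structure with the operations, relations and metric of $E$. A structure is *finitely generated* if it is isomorphic to such an $\langle\bar a\rangle$ with $E\in\mathcal{A}$. Products below are over nonempty index sets. Consider the following conditions on a class $\mathcal{K}\subset\mathcal{A}$ (with morphisms between its members): 1. a structure is in $\mathcal{K}$ iff $\langle\bar a\rangle\in\mathcal{K}$ for each of its finite tuples $\bar a$; 2. $\mathcal{K}$ is closed under inductive limits of directed systems with embeddings as connective maps; 3. $\mathcal{K}$ has arbitrary products; 4. $\mathcal{K}$ has an initial object, which is finitely generated; 5. if $f:X\to\prod_iY_i$ is the morphism in $\mathcal{K}$ with components $f_i:X\to Y_i$, then $\varphi(f(\bar a))=\sup_i\varphi(f_i(\bar a))$ for all atomic $\varphi$ and tuples $\bar a$ in $X$; 6. if $f^{(k)}:A\to X\times Y$ are the morphisms in $\mathcal{K}$ with components $f_X^{(k)},f_Y^{(k)}$, $k=1,\dots,n$, then $\varphi(f^{(1)}(\bar a),\dots,f^{(n)}(\bar a))\le\max\{\varphi(f_X^{(1)}(\bar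 a),\dots,f_X^{(n)}(\bar a)),\varphi(f_Y^{(1)}(\bar a),\dots,f_Y^{(n)}(\bar a))\}$ for all atomic $\varphi$ and tuples $\bar a$ in $A$; 7. for finitely generated $A,B\in\mathcal{K}$ the space of morphisms $A\to B$ is totally bounded for $d$; 8. each $X\in\mathcal{K}$ can be endowed with a collection of finite tuples of pairwise distinct elements, called basic, such that: every finitely generated $X\in\mathcal{K}$ has a basic tuple $\bar a$ with $\langle\bar a\rangle=X$; every finite tuple contains a basic subtuple; every separable $X\in\mathcal{K}$ has a countable subset $D$ such that $\bigcup\{\langle\bar a\rangle:\bar a\text{ a finite tuple in }D\}$ is dense in $X$ and the basic tuples from $D$ are dense among the basic tuples of $X$; and for every basic tuple $\bar a$ in $X\in\mathcal{K}$ there are $\delta_{\bar a}>0$ and a strictly increasing $\rho_{\bar a}:[0,\delta_{\bar a})\to[0,\infty)$, vanishing and continuous at $0$, such that for all morphisms $f,g:X\to Y$ with $Y\in\mathcal{K}$ and $d(f(\bar a),g(\bar a))\le\delta<\delta_{\bar a}$ there is a morphism $h:\langle f(\bar a)\rangle\to Y$ with $d(h(f(x)),g(x))\le\rho_{\bar a}(\delta)$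 for all $x\in\langle\bar a\rangle$. Let $\varpi:[0,\infty)\to[0,\infty)$ be strictly increasing, vanishing at $0$ and continuous at $0$. A class $\mathcal{K}\subset\mathcal{A}$ *has enough injectives from* $\mathcal{J}\subset\mathcal{K}$ *with modulus* $\varpi$ if every finitely generated structure in $\mathcal{K}$ is a Gromov–Hausdorff limit of structures $\langle\bar a\rangle$, $\bar a$ a finite tuple in some $A\in\mathcal{J}$, and whenever $X,\widehat X\in\mathcal{K}$ and $A\in\mathcal{J}$ are separable, $X$ is finitely generated, and $\phi:X\to\widehat X$, $f:X\to A$ are morphisms with $I(\phi)\le\delta$, there is a morphism $h:\widehat X\to A$ with $d(h\circ\phi,f)\le\varpi(\delta)$. **Stratified Fraïssé class.** Let $\mathcal{A}_q\subset\mathcal{A}$ ($q\in\mathbb{N}$) be classes with $\mathcal{A}_q\subset\mathcal{A}_{q+1}$, and let $\mathcal{I}_q\subset\mathcal{A}_q$ be countable collections of separable structures, injective in $\mathcal{A}_q$ (morphisms into them extend along embeddings), closed under finite products in $\mathcal{A}_q$, with $\mathcal{I}_q\subset\mathcal{I}_{q+1}$. Let $\mathcal{I}_\infty=\bigcup_q\mathcal{I}_q$,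 and let $\mathcal{I}\subset\mathcal{I}_\infty$ be such that every structure in $\mathcal{I}_\infty$ embeds in a structure in $\mathcal{I}$. Assume that $\mathcal{A}$ satisfies (1), (2), (4), has finite products, and that $I(T)<\infty$ for the morphisms $T$ from its initial object to structures in $\mathcal{A}$; that every $\mathcal{A}_q$ satisfies (1)–(8); that $\mathcal{A}_q$ has enough injectives from $\mathcal{I}_q$ with modulus $\varpi$ for every $q$; and that $\mathcal{A}$ has enough injectives from $\mathcal{I}_\infty$ with modulus $\varpi$. Let $M$ be the *Fraïssé limit* of the class of finitely generated structures in $\mathcal{A}$, that is, a separable structure in $\mathcal{A}$ with the approximate extension property: whenever $E,F\in\mathcal{A}$ are finitely generated, $\delta,\varepsilon>0$, and $\phi:E\to F$, $f:E\to M$ are morphisms with $I(\phi)<\delta$ and $I(f)<\delta$, there is a morphism $g:F\to M$ with $I(g)<\varepsilon$ and $d(g\circ\phi,f)<\varpi(\delta)$. A structure $X\in\mathcal{A}$ is *approximately injective* if for every $A\in\mathcal{I}$, finite tuple $\bar a$ in $A$, morphism $f:\langle\bar a\rangle\to X$ and $\varepsilon>0$ there is a morphism $g:A\to X$ with $d(g(\bar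 a),f(\bar a))\le\varepsilon$. **Theorem.** A separable structure $X$ in $\mathcal{A}$ is approximately injective if and only if there exist an embedding $\eta:X\to M$ and an idempotent morphism $\pi:M\to M$ such that the range of $\eta$ equals the range of $\pi$. -/

import Mathlib

open scoped NNReal ENNReal

namespace MetricFraisse

universe v u w

/-- A countable single-sorted language for metric structures: function and relation symbols with
arities and moduli of continuity; relation symbols take values in a compact interval. The
distinguished symbol for the metric is built into `Atomic` below. -/
structure Language where
  Fn : Type v
  Rel : Type v
  fn_countable : Countable Fn
  rel_countable : Countable Rel
  fnArity : Fn → ℕ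
  relArity : Rel → ℕ
  fnMod : Fn → ℝ≥0 → ℝ≥0
  relMod : Rel → ℝ≥0 → ℝ≥0
  fnMod_zero : ∀ f, fnMod f 0 = 0
  relMod_zero : ∀ R, relMod R 0 = 0
  fnMod_cont : ∀ f, ContinuousAt (fnMod f) 0
  relMod_cont : ∀ R, ContinuousAt (relMod R) 0
  lo : Rel → ℝ
  hi : Rel → ℝ
  lo_le_hi : ∀ R, lo R ≤ hi R

/-- An `L`-structure: a complete metric space with metric bounded by `1` and interpretations of the
symbols of `L` respecting the moduli, with respect to the supremum metric on tuples. -/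
structure Str (L : Language.{v}) where
  carrier : Type u
  [metric : MetricSpace carrier]
  [complete : CompleteSpace carrier]
  dist_le_one : ∀ x y : carrier, dist x y ≤ 1
  fn : ∀ f : L.Fn, (Fin (L.fnArity f) → carrier) → carrier
  fn_mod : ∀ f x y, nndist (fn f x) (fn f y) ≤ L.fnMod f (nndist x y)
  rel : ∀ R : L.Rel, (Fin (L.relArity R) → carrier) → ℝ
  rel_mem : ∀ R x, rel R x ∈ Set.Icc (L.lo R) (L.hi R)
  rel_mod : ∀ R x y, nndist (rel R x) (rel R y) ≤ L.relMod R (nndist x y)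

variable {L : Language.{v}}

instance : CoeSort (Str.{v, u} L) (Type u) := ⟨Str.carrier⟩
instance (X : Str.{v, u} L) : MetricSpace X := X.metric
instance (X : Str.{v, u} L) : CompleteSpace X := X.complete

/-- Terms in variables indexed by `α`. -/
inductive Term (L : Language.{v}) (α : Type w) : Type (max v w)
  | var : α → Term L α
  | app : (f : L.Fn) → (Fin (L.fnArity f) → Term L α) → Term L α

/-- Atomic formulas in variables indexed by `α`. -/
inductive Atomic (L : Language.{v}) (α : Type w) : Type (max v w)
  | dist : Term L α → Term L α → Atomic L α
  | rel : (R : L.Rel) → (Fin (L.relArity R) → Term L α) → Atomic L α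

/-- Value of a term in a structure. -/
def Term.eval {α : Type w} (X : Str.{v, u} L) (a : α → X) : Term L α → X
  | .var i => a i
  | .app f ts => X.fn f fun k => (ts k).eval X a

/-- Value of an atomic formula in a structure. -/
def Atomic.eval {α : Type w} (X : Str.{v, u} L) (a : α → X) : Atomic L α → ℝ
  | .dist s t => Dist.dist (s.eval X a) (t.eval X a)
  | .rel R ts => X.rel R fun k => (ts k).eval X a

/-- Morphisms do not increase the values of atomic formulas. -/
def IsMorphism {E F : Str.{v, u} L} (T : E → F) : Prop :=
  ∀ (n : ℕ) (φ : Atomic L (Fin n)) (a : Fin n → E),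
    φ.eval F (fun i => T (a i)) ≤ φ.eval E a

/-- Embeddings preserve the values of atomic formulas. -/
def IsEmbedding {E F : Str.{v, u} L} (T : E → F) : Prop :=
  ∀ (n : ℕ) (φ : Atomic L (Fin n)) (a : Fin n → E),
    φ.eval F (fun i => T (a i)) = φ.eval E a

/-- The distortion `I(T)`: the supremum of `|φ(a) - φ(T a)|` over atomic formulas and tuples. -/
noncomputable def distortion {E F : Str.{v, u} L} (T : E → F) : ℝ≥0∞ :=
  ⨆ (n : ℕ) (φ : Atomic L (Fin n)) (a : Fin n → E),
    ENNReal.ofReal |φ.eval E a - φ.eval F (fun i => T (a i))|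

/-- The uniform distance `d(S, T)`. -/
noncomputable def unifDist {E F : Str.{v, u} L} (S T : E → F) : ℝ≥0∞ :=
  ⨆ x : E, edist (S x) (T x)

/-- The Gromov-Hausdorff distance of two structures. -/
noncomputable def ghDist (X Y : Str.{v, u} L) : ℝ≥0∞ :=
  sInf {ε : ℝ≥0∞ | 0 < ε ∧ ∃ (f : X → Y) (g : Y → X), IsMorphism f ∧ IsMorphism g ∧
    unifDist (g ∘ f) id < ε ∧ unifDist (f ∘ g) id < ε ∧ distortion f < ε ∧ distortion g < ε}

theorem IsMorphism.dist_le {E F : Str.{v, u} L} {T : E → F} (hT : IsMorphism T) (x y : E) :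
    dist (T x) (T y) ≤ dist x y := by
  have h := hT 2 (.dist (.var 0) (.var 1)) ![x, y]
  simpa [Atomic.eval, Term.eval] using h

theorem IsMorphism.continuous {E F : Str.{v, u} L} {T : E → F} (hT : IsMorphism T) :
    Continuous T :=
  (LipschitzWith.of_dist_le_mul (K := 1) (by simpa using hT.dist_le)).continuous

theorem IsMorphism.map_fn {E F : Str.{v, u} L} {T : E → F} (hT : IsMorphism T) (f : L.Fn)
    (x : Fin (L.fnArity f) → E) : T (E.fn f x) = F.fn f (fun i => T (x i)) := by
  have h := hT (L.fnArity f + 1)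
    (.dist (.app f fun i => .var i.castSucc) (.var (Fin.last _))) (Fin.snoc x (E.fn f x))
  simp only [Atomic.eval, Term.eval, Fin.snoc_castSucc, Fin.snoc_last, dist_self] at h
  exact (dist_le_zero.mp h).symm

section Generated

variable (𝒜 : Set (Str.{v, u} L)) {E : Str.{v, u} L} {n : ℕ} (a : Fin n → E)

/-- `⟨a⟩`: the elements of `E` at which any two morphisms from `E` to a structure in the ambient
class `𝒜` agree as soon as they agree on the tuple `a`. -/
def gen : Set E :=
  {b | ∀ F ∈ 𝒜, ∀ f g : E → F, IsMorphism f → IsMorphism g →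
    (∀ i, f (a i) = g (a i)) → f b = g b}

theorem mem_gen (i : Fin n) : a i ∈ gen 𝒜 a := fun _ _ _ _ _ _ h => h i

theorem isClosed_gen : IsClosed (gen 𝒜 a) := by
  simp only [gen, Set.ofPred_forall]
  refine isClosed_iInter fun F => isClosed_iInter fun _ => isClosed_iInter fun f =>
    isClosed_iInter fun g => isClosed_iInter fun hf => isClosed_iInter fun hg =>
    isClosed_iInter fun _ => isClosed_eq hf.continuous hg.continuous

theorem fn_mem_gen (f : L.Fn) (x : Fin (L.fnArity f) → E) (hx : ∀ i, x i ∈ gen 𝒜 a) :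
    E.fn f x ∈ gen 𝒜 a := by
  intro F hF p q hp hq h
  rw [hp.map_fn, hq.map_fn]
  congr 1
  funext i
  exact hx i F hF p q hp hq h

/-- `⟨a⟩` as a structure, with the operations and relations of `E`. -/
def genStr : Str.{v, u} L where
  carrier := gen 𝒜 a
  metric := inferInstance
  complete := (isClosed_gen 𝒜 a).completeSpace_coe
  dist_le_one x y := E.dist_le_one x y
  fn f x := ⟨E.fn f fun i => (x i).1, fn_mem_gen 𝒜 a f _ fun i => (x i).2⟩
  fn_mod f x y := E.fn_mod f (fun i => (x i).1) (fun i => (y i).1)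
  rel R x := E.rel R fun i => (x i).1
  rel_mem R _ := E.rel_mem R _
  rel_mod R x y := E.rel_mod R (fun i => (x i).1) (fun i => (y i).1)

/-- The inclusion of `⟨a⟩` in `E`. -/
def genVal : genStr 𝒜 a → E := Subtype.val

/-- The tuple `a`, seen in `⟨a⟩`. -/
def genTuple : Fin n → genStr 𝒜 a := fun i => ⟨a i, mem_gen 𝒜 a i⟩

end Generated

/-- Finitely generated structures: those isomorphic to some `⟨a⟩`, for a finite tuple `a` in a
structure in `𝒜` (in particular every `X ∈ 𝒜` with `X = ⟨a⟩` for a finite tuple `a` in `X`). -/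
def FG (𝒜 : Set (Str.{v, u} L)) (X : Str.{v, u} L) : Prop :=
  ∃ Y ∈ 𝒜, ∃ (n : ℕ) (a : Fin n → Y) (e : X → genStr 𝒜 a),
    IsEmbedding e ∧ Function.Surjective e

/-- `(P, π)` is a product of the family `Y` in the full subcategory `𝒦`. -/
def IsProduct (𝒦 : Set (Str.{v, u} L)) {ι : Type w} (Y : ι → Str.{v, u} L) (P : Str.{v, u} L)
    (π : ∀ i, P → Y i) : Prop :=
  P ∈ 𝒦 ∧ (∀ i, IsMorphism (π i)) ∧
    ∀ Z ∈ 𝒦, ∀ f : ∀ i, Z → Y i, (∀ i, IsMorphism (f i)) →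
      ∃! h : Z → P, IsMorphism h ∧ ∀ i z, π i (h z) = f i z

/-- `(X, j)` is the inductive limit of the directed system `(Y, t)` of structures and embeddings:
the completion of the union of the system. -/
structure IsInductiveLimit {ι : Type u} [Preorder ι] (Y : ι → Str.{v, u} L)
    (t : ∀ i k, i ≤ k → Y i → Y k) (X : Str.{v, u} L) (j : ∀ i, Y i → X) : Prop where
  conn_embedding : ∀ i k h, IsEmbedding (t i k h)
  conn_refl : ∀ i y, t i i le_rfl y = y
  conn_trans : ∀ i k l (h : i ≤ k) (h' : k ≤ l) y, t k l h' (t i k h y) = t i l (h.trans h') y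
  embedding : ∀ i, IsEmbedding (j i)
  compat : ∀ i k h y, j k (t i k h y) = j i y
  dense : Dense (⋃ i, Set.range (j i))

/-- `A₀` is an initial object of the full subcategory `𝒦`. -/
def IsInitialObject (𝒦 : Set (Str.{v, u} L)) (A₀ : Str.{v, u} L) : Prop :=
  A₀ ∈ 𝒦 ∧ ∀ X ∈ 𝒦, ∃! i : A₀ → X, IsMorphism i

/-- The requirements on a class `𝒦 ⊆ 𝒜` common to the ambient class and to its strata. -/
structure BaseConditions (𝒜 𝒦 : Set (Str.{v, u} L)) : Prop where
  mem_iff : ∀ X : Str.{v, u} L, X ∈ 𝒦 ↔ ∀ (n : ℕ) (a : Fin n → X), genStr 𝒜 a ∈ 𝒦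
  limit_mem : ∀ {ι : Type u} [Preorder ι] [Nonempty ι] [IsDirectedOrder ι]
    (Y : ι → Str.{v, u} L) (t : ∀ i k, i ≤ k → Y i → Y k) (X : Str.{v, u} L) (j : ∀ i, Y i → X),
    (∀ i, Y i ∈ 𝒦) → IsInductiveLimit Y t X j → X ∈ 𝒦
  initial : ∃ A₀ : Str.{v, u} L, FG 𝒜 A₀ ∧ IsInitialObject 𝒦 A₀

/-- A collection `B` of tuples in `X` being given, `D` is fundamental in `X`: it generates a dense
substructure, and the tuples of `B` from `D` are dense among all tuples of `B`. -/
def IsFundamental (𝒜 : Set (Str.{v, u} L)) (X : Str.{v, u} L) (B : ∀ n, Set (Fin n → X))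
    (D : Set X) : Prop :=
  Dense {x : X | ∃ (n : ℕ) (a : Fin n → X), (∀ i, a i ∈ D) ∧ x ∈ gen 𝒜 a} ∧
    ∀ n, ∀ a ∈ B n, ∀ ε > 0, ∃ b ∈ B n, (∀ i, b i ∈ D) ∧ dist a b < ε

/-- The requirements on the basic tuples `B X n` of the structures `X` in `𝒦`. -/
structure IsBasicSystem (𝒜 𝒦 : Set (Str.{v, u} L))
    (B : ∀ (X : Str.{v, u} L) (n : ℕ), Set (Fin n → X)) : Prop where
  distinct : ∀ X ∈ 𝒦, ∀ n, ∀ a ∈ B X n, Function.Injective a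
  generating : ∀ X ∈ 𝒦, FG 𝒜 X → ∃ n, ∃ a ∈ B X n, gen 𝒜 a = Set.univ
  subtuple : ∀ X ∈ 𝒦, ∀ (n : ℕ) (a : Fin n → X),
    ∃ (m : ℕ) (s : Fin m → Fin n), StrictMono s ∧ a ∘ s ∈ B X m
  fundamental : ∀ X ∈ 𝒦, TopologicalSpace.SeparableSpace X →
    ∃ D : Set X, D.Countable ∧ IsFundamental 𝒜 X (B X) D
  perturbation : ∀ X ∈ 𝒦, ∀ n, ∀ a ∈ B X n, ∃ (δ₀ : ℝ≥0) (ρ : ℝ≥0 → ℝ≥0), 0 < δ₀ ∧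
    StrictMonoOn ρ (Set.Iio δ₀) ∧ ρ 0 = 0 ∧ ContinuousAt ρ 0 ∧
    ∀ Y ∈ 𝒦, ∀ f g : X → Y, IsMorphism f → IsMorphism g → ∀ δ < δ₀,
      nndist (f ∘ a) (g ∘ a) ≤ δ →
      ∃ h : genStr 𝒜 (f ∘ a) → Y, IsMorphism h ∧
        ∀ x ∈ gen 𝒜 a, ∀ z : genStr 𝒜 (f ∘ a), genVal 𝒜 (f ∘ a) z = f x →
          nndist (h z) (g x) ≤ ρ δ

/-- The full list of requirements, satisfied by the strata. Products are over nonempty families. -/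
structure FullConditions (𝒜 𝒦 : Set (Str.{v, u} L)) : Prop extends BaseConditions 𝒜 𝒦 where
  products : ∀ {ι : Type u} [Nonempty ι] (Y : ι → Str.{v, u} L), (∀ i, Y i ∈ 𝒦) →
    ∃ (P : Str.{v, u} L) (π : ∀ i, P → Y i), IsProduct 𝒦 Y P π
  product_sup : ∀ {ι : Type u} [Nonempty ι] (Y : ι → Str.{v, u} L), (∀ i, Y i ∈ 𝒦) →
    ∀ (P : Str.{v, u} L) (π : ∀ i, P → Y i), IsProduct 𝒦 Y P π →
    ∀ X ∈ 𝒦, ∀ (f : ∀ i, X → Y i) (h : X → P), (∀ i, IsMorphism (f i)) → IsMorphism h →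
      (∀ i x, π i (h x) = f i x) →
      ∀ (n : ℕ) (φ : Atomic L (Fin n)) (a : Fin n → X),
        IsLUB (Set.range fun i => φ.eval (Y i) (fun k => f i (a k)))
          (φ.eval P (fun k => h (a k)))
  product_max : ∀ Y : Bool → Str.{v, u} L, (∀ i, Y i ∈ 𝒦) →
    ∀ (Z : Str.{v, u} L) (π : ∀ i, Z → Y i), IsProduct 𝒦 Y Z π →
    ∀ A ∈ 𝒦, ∀ (n : ℕ) (fX : Fin n → A → Y false) (fY : Fin n → A → Y true) (f : Fin n → A → Z),
      (∀ k, IsMorphism (fX k)) → (∀ k, IsMorphism (fY k)) → (∀ k, IsMorphism (f k)) →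
      (∀ k x, π false (f k x) = fX k x) → (∀ k x, π true (f k x) = fY k x) →
      ∀ (m : ℕ) (φ : Atomic L (Fin n × Fin m)) (a : Fin m → A),
        φ.eval Z (fun p => f p.1 (a p.2)) ≤
          max (φ.eval (Y false) (fun p => fX p.1 (a p.2)))
            (φ.eval (Y true) (fun p => fY p.1 (a p.2)))
  totally_bounded : ∀ A ∈ 𝒦, ∀ B ∈ 𝒦, FG 𝒜 A → FG 𝒜 B → ∀ ε : ℝ≥0∞, 0 < ε →
    ∃ S : Set (A → B), S.Finite ∧ (∀ g ∈ S, IsMorphism g) ∧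
      ∀ f : A → B, IsMorphism f → ∃ g ∈ S, unifDist f g < ε
  basic : ∃ B : ∀ (X : Str.{v, u} L) (n : ℕ), Set (Fin n → X), IsBasicSystem 𝒜 𝒦 B

/-- Injective objects of the full subcategory `𝒦`: morphisms extend along embeddings. -/
def IsInjective (𝒦 : Set (Str.{v, u} L)) (A : Str.{v, u} L) : Prop :=
  A ∈ 𝒦 ∧ ∀ X ∈ 𝒦, ∀ Y ∈ 𝒦, ∀ (i : X → Y) (f : X → A), IsEmbedding i → IsMorphism f →
    ∃ g : Y → A, IsMorphism g ∧ ∀ x, g (i x) = f x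

/-- `𝒦` has enough injectives from `ℐ` with modulus `ϖ`. -/
structure EnoughInjectives (𝒜 𝒦 ℐ : Set (Str.{v, u} L)) (ϖ : ℝ≥0 → ℝ≥0) : Prop where
  approx : ∀ X ∈ 𝒦, FG 𝒜 X → ∀ ε : ℝ≥0∞, 0 < ε →
    ∃ A ∈ ℐ, ∃ (n : ℕ) (a : Fin n → A), ghDist X (genStr 𝒜 a) < ε
  extend : ∀ X ∈ 𝒦, ∀ X' ∈ 𝒦, ∀ A ∈ ℐ, FG 𝒜 X → TopologicalSpace.SeparableSpace X →
    TopologicalSpace.SeparableSpace X' → TopologicalSpace.SeparableSpace A →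
    ∀ (φ : X → X') (f : X → A) (δ : ℝ≥0), IsMorphism φ → IsMorphism f → distortion φ ≤ δ →
      ∃ h : X' → A, IsMorphism h ∧ unifDist (h ∘ φ) f ≤ ϖ δ

/-- A modulus: strictly increasing, vanishing at `0` and continuous at `0`. -/
def IsModulus (ϖ : ℝ≥0 → ℝ≥0) : Prop :=
  StrictMono ϖ ∧ ϖ 0 = 0 ∧ ContinuousAt ϖ 0

/-- A stratified Fraïssé class generated by injective objects: the ambient class `𝒜`, its strata
`𝒜q q`, the countable collections `ℐq q` of injective structures, and a cofinal collection `ℐ` in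
their union `ℐ_∞`. The distortion of a morphism from the initial object is taken to be a (finite)
number; this is automatic if the ranges of the relation symbols are uniformly bounded. -/
structure IsStratifiedClass (𝒜 : Set (Str.{v, u} L)) (𝒜q ℐq : ℕ → Set (Str.{v, u} L))
    (ℐ : Set (Str.{v, u} L)) (ϖ : ℝ≥0 → ℝ≥0) : Prop where
  modulus : IsModulus ϖ
  stratum_subset : ∀ q, 𝒜q q ⊆ 𝒜
  stratum_mono : ∀ q, 𝒜q q ⊆ 𝒜q (q + 1)
  inj_countable : ∀ q, (ℐq q).Countable
  inj_mono : ∀ q, ℐq q ⊆ ℐq (q + 1)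
  inj_separable : ∀ q, ∀ A ∈ ℐq q, TopologicalSpace.SeparableSpace A
  inj_injective : ∀ q, ∀ A ∈ ℐq q, IsInjective (𝒜q q) A
  inj_products : ∀ q, ∀ Y : Bool → Str.{v, u} L, (∀ i, Y i ∈ ℐq q) →
    ∃ P ∈ ℐq q, ∃ π : ∀ i, P → Y i, IsProduct (𝒜q q) Y P π
  cofinal_subset : ℐ ⊆ ⋃ q, ℐq q
  cofinal : ∀ B ∈ ⋃ q, ℐq q, ∃ A ∈ ℐ, ∃ i : B → A, IsEmbedding i
  base : BaseConditions 𝒜 𝒜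
  initial_finite : ∀ A₀, IsInitialObject 𝒜 A₀ → ∀ X ∈ 𝒜, ∀ i : A₀ → X, IsMorphism i →
    distortion i < ⊤
  finite_products : ∀ Y : Bool → Str.{v, u} L, (∀ i, Y i ∈ 𝒜) →
    ∃ (P : Str.{v, u} L) (π : ∀ i, P → Y i), IsProduct 𝒜 Y P π
  strata : ∀ q, FullConditions 𝒜 (𝒜q q)
  strata_enough : ∀ q, EnoughInjectives 𝒜 (𝒜q q) (ℐq q) ϖ
  enough : EnoughInjectives 𝒜 𝒜 (⋃ q, ℐq q) ϖ

/-- `M` is the Fraïssé limit of the finitely generated structures in `𝒜`: a separable structure in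
`𝒜` with the approximate extension property with modulus `ϖ`. -/
def IsFraisseLimit (𝒜 : Set (Str.{v, u} L)) (ϖ : ℝ≥0 → ℝ≥0) (M : Str.{v, u} L) : Prop :=
  M ∈ 𝒜 ∧ TopologicalSpace.SeparableSpace M ∧
    ∀ E ∈ 𝒜, ∀ F ∈ 𝒜, FG 𝒜 E → FG 𝒜 F →
    ∀ (φ : E → F) (f : E → M) (δ ε : ℝ≥0), 0 < δ → 0 < ε → IsMorphism φ → IsMorphism f →
      distortion φ < δ → distortion f < δ →
      ∃ g : F → M, IsMorphism g ∧ distortion g < ε ∧ unifDist (g ∘ φ) f < ϖ δ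

/-- Approximate injectivity: morphisms to `X` from `⟨a⟩`, for a finite tuple `a` in a structure
`A ∈ ℐ`, extend to `A` up to an arbitrarily small error on `a`. -/
def IsApproxInjective (𝒜 ℐ : Set (Str.{v, u} L)) (X : Str.{v, u} L) : Prop :=
  ∀ A ∈ ℐ, ∀ (n : ℕ) (a : Fin n → A) (f : genStr 𝒜 a → X), IsMorphism f → ∀ ε : ℝ, 0 < ε →
    ∃ g : A → X, IsMorphism g ∧ dist (g ∘ a) (f ∘ genTuple 𝒜 a) ≤ ε

end MetricFraisse


/-!
Both the Fraïssé limit `M` and a separable approximately injective `X` have identities that factor,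
up to a small error on a given finite set, through the injective structures in `ℐ_∞`: for `X` this
is approximate injectivity, and for `M` it holds because `M` almost inverts, by embeddings, every
morphism of small distortion. Let `j : X → M` and `r : M → X` be morphisms such that `r ∘ j` is
`δ`-close to the identity on a finite set. Through the factorizations they induce morphisms
`g : C → A` and `f : A → C` with `A, C ∈ ℐ_∞`. The graph maps `(g, id) : C → A × C` and
`(id, f) ∘ g : C → A × C` are `δ`-close, because the metric of a product is the maximum metric, and
`(g, id)` has the exact left inverse `snd`. Embedding `A × C` in `M` therefore yields a pair `j'`,
`r'` near `j`, `r`, for which `r' ∘ j'` is arbitrarily close to the identity. Iterating and passing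
to the limit exhibits `X` as a retract of `M`.
-/

namespace MetricFraisse

open Filter Set TopologicalSpace
open scoped Topology

universe v u w

variable {L : Language.{v}}

/-! ### Metric preliminaries -/

section Metric

variable {α β : Type*} [PseudoMetricSpace α] [PseudoMetricSpace β]

theorem continuous_of_nndist_le_modulus {f : α → β} {ω : ℝ≥0 → ℝ≥0} (hω₀ : ω 0 = 0)
    (hω : ContinuousAt ω 0) (h : ∀ x y, nndist (f x) (f y) ≤ ω (nndist x y)) : Continuous f := by
  refine continuous_iff_continuousAt.2 fun x => tendsto_iff_dist_tendsto_zero.2 ?_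
  have hnndist : Tendsto (fun y => nndist y x) (𝓝 x) (𝓝 0) :=
    (by fun_prop : Continuous fun y => nndist y x).tendsto' x 0 (nndist_self x)
  have hmod : Tendsto (fun y => ω (nndist y x)) (𝓝 x) (𝓝 0) := (hω.tendsto.comp hnndist).trans
    (by rw [hω₀])
  exact squeeze_zero (fun _ => dist_nonneg) (fun y => NNReal.coe_le_coe.2 (h y x))
    (NNReal.tendsto_coe.2 hmod)

theorem cauchySeq_of_eventually_le_geometric_two {u : ℕ → α} {C : ℝ} {N₀ : ℕ}
    (h : ∀ N ≥ N₀, dist (u N) (u (N + 1)) ≤ C / 2 / 2 ^ N) : CauchySeq u := by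
  rw [← cauchySeq_shift N₀]
  refine cauchySeq_of_le_geometric_two (C := C / 2 ^ N₀) fun N => ?_
  rw [add_right_comm]
  exact (h (N + N₀) (Nat.le_add_left N₀ N)).trans_eq (by rw [pow_add]; ring)

theorem cauchySeq_apply_of_dense {f : ℕ → α → β} (hf : ∀ N, LipschitzWith 1 (f N)) {D : Set α}
    (hD : Dense D) (hcauchy : ∀ x ∈ D, CauchySeq fun N => f N x) (x : α) :
    CauchySeq fun N => f N x := by
  rw [Metric.cauchySeq_iff]
  intro ε hε
  obtain ⟨y, hy, hxy⟩ := hD.exists_dist_lt x (show 0 < ε / 3 by positivity)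
  obtain ⟨N, hN⟩ := Metric.cauchySeq_iff.1 (hcauchy y hy) (ε / 3) (by positivity)
  have hclose : ∀ k, dist (f k x) (f k y) < ε / 3 := fun k => by
    simpa using ((hf k).dist_le_mul x y).trans_lt (by simpa using hxy)
  refine ⟨N, fun k hk l hl => ?_⟩
  calc dist (f k x) (f l x)
      ≤ dist (f k x) (f k y) + dist (f k y) (f l y) + dist (f l y) (f l x) := dist_triangle4 ..
    _ < ε := by linarith [hclose k, dist_comm (f l y) (f l x), hclose l, hN k hk l hl]

theorem tendsto_apply_of_lipschitzWith_one {f : ℕ → α → β} (hf : ∀ N, LipschitzWith 1 (f N))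
    {u : ℕ → α} {x : α} {y : β} (hu : Tendsto u atTop (𝓝 x))
    (hfx : Tendsto (fun N => f N x) atTop (𝓝 y)) : Tendsto (fun N => f N (u N)) atTop (𝓝 y) := by
  rw [tendsto_iff_dist_tendsto_zero] at hu hfx ⊢
  refine squeeze_zero (fun _ => dist_nonneg) (fun N => ?_) (by simpa using hu.add hfx)
  have hlip : dist (f N (u N)) (f N x) ≤ dist (u N) x := by simpa using (hf N).dist_le_mul (u N) x
  linarith [dist_triangle (f N (u N)) (f N x) y]

theorem tendsto_const_div_two_pow_atTop (C : ℝ) :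
    Tendsto (fun N : ℕ => C / 2 ^ N) atTop (𝓝 0) :=
  tendsto_const_nhds.div_atTop (tendsto_pow_atTop_atTop_of_one_lt one_lt_two)

theorem exists_monotone_finite_dense_iUnion (α : Type*) [TopologicalSpace α] [SeparableSpace α] :
    ∃ S : ℕ → Set α, Monotone S ∧ (∀ N, (S N).Finite) ∧ Dense (⋃ N, S N) := by
  rcases isEmpty_or_nonempty α with _ | _
  · exact ⟨fun _ => ∅, monotone_const, fun _ => finite_empty, fun x => isEmptyElim x⟩
  · refine ⟨fun N => denseSeq α '' Iio N, fun _ _ h => image_mono (Iio_subset_Iio h),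
      fun N => (finite_Iio N).image _, ?_⟩
    rw [← image_iUnion, iUnion_Iio, image_univ]
    exact denseRange_denseSeq α

end Metric

theorem exists_seq_of_forall_exists_succ {α : ℕ → Type w} {P : ∀ N, α N → Prop}
    {R : ∀ N, α N → α (N + 1) → Prop} (a₀ : α 0) (h₀ : P 0 a₀)
    (h : ∀ N a, P N a → ∃ b, P (N + 1) b ∧ R N a b) :
    ∃ f : ∀ N, α N, f 0 = a₀ ∧ (∀ N, P N (f N)) ∧ ∀ N, R N (f N) (f (N + 1)) := by
  choose next hP hR using h
  let f : ∀ N, {a : α N // P N a} :=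
    fun N => Nat.rec ⟨a₀, h₀⟩ (fun N a => ⟨next N a.1 a.2, hP N a.1 a.2⟩) N
  exact ⟨fun N => (f N).1, rfl, fun N => (f N).2, fun N => hR N _ _⟩

theorem exists_extend_of_dense_iUnion {α : Type*} {β : Type w} [TopologicalSpace α] {D : ℕ → Set α}
    (hD : Dense (⋃ N, D N)) (g : ∀ N, D N → β) :
    ∃ g' : ℕ → α → β, ∀ N (x : D N), g' N x = g N x := by
  rcases isEmpty_or_nonempty β with hβ | ⟨⟨b⟩⟩
  · have : IsEmpty α := by
      by_contra! hα
      obtain ⟨x, hx⟩ := hD.nonempty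
      obtain ⟨N, hN⟩ := mem_iUnion.1 hx
      exact hβ.elim (g N ⟨x, hN⟩)
    exact ⟨fun _ x => isEmptyElim x, fun _ x => isEmptyElim x.1⟩
  · exact ⟨fun N => Function.extend Subtype.val (g N) fun _ => b,
      fun N => Subtype.val_injective.extend_apply (g N) _⟩

theorem IsModulus.exists_lt {ϖ : ℝ≥0 → ℝ≥0} (hϖ : IsModulus ϖ) {ε : ℝ} (hε : 0 < ε) :
    ∃ δ : ℝ≥0, 0 < δ ∧ (δ : ℝ) < ε ∧ (ϖ δ : ℝ) < ε := by
  lift ε to ℝ≥0 using hε.le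
  obtain ⟨-, hϖ₀, hcont⟩ := hϖ
  have hsmall : ∀ᶠ δ in 𝓝 (0 : ℝ≥0), δ < ε ∧ ϖ δ < ε :=
    (eventually_lt_nhds (NNReal.coe_pos.1 hε)).and
      (hcont.eventually_lt_const (hϖ₀.trans_lt (NNReal.coe_pos.1 hε)))
  obtain ⟨δ, ⟨hδ, hϖδ⟩, hδ₀⟩ :=
    ((hsmall.filter_mono nhdsWithin_le_nhds).and (self_mem_nhdsWithin (s := Ioi 0))).exists
  exact ⟨δ, hδ₀, NNReal.coe_lt_coe.2 hδ, NNReal.coe_lt_coe.2 hϖδ⟩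

/-! ### Morphisms and embeddings -/

section Morphism

variable {E F G : Str.{v, u} L}

theorem isMorphism_id : IsMorphism (id : E → E) := fun _ _ _ => le_rfl

theorem IsMorphism.comp {S : F → G} {T : E → F} (hS : IsMorphism S) (hT : IsMorphism T) :
    IsMorphism (S ∘ T) :=
  fun n φ a => (hS n φ fun i => T (a i)).trans (hT n φ a)

theorem IsMorphism.lipschitzWith {T : E → F} (hT : IsMorphism T) : LipschitzWith 1 T :=
  LipschitzWith.of_dist_le_mul fun x y => by simpa using hT.dist_le x y

theorem IsMorphism.isEmbedding_of_leftInverse {T : E → F} {S : F → E} (hT : IsMorphism T)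
    (hS : IsMorphism S) (h : Function.LeftInverse S T) : IsEmbedding T := by
  refine fun n φ a => le_antisymm (hT n φ a) ?_
  simpa only [h _] using hS n φ fun i => T (a i)

theorem IsEmbedding.isMorphism {T : E → F} (hT : IsEmbedding T) : IsMorphism T :=
  fun n φ a => (hT n φ a).le

theorem IsEmbedding.comp {S : F → G} {T : E → F} (hS : IsEmbedding S) (hT : IsEmbedding T) :
    IsEmbedding (S ∘ T) :=
  fun n φ a => (hS n φ fun i => T (a i)).trans (hT n φ a)

theorem IsEmbedding.isMorphism_of_comp {S : F → G} {T : E → F} (hS : IsEmbedding S)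
    (hST : IsMorphism (S ∘ T)) : IsMorphism T :=
  fun n φ a => (hS n φ fun i => T (a i)).symm.le.trans (hST n φ a)

theorem IsEmbedding.dist_eq {T : E → F} (hT : IsEmbedding T) (x y : E) :
    dist (T x) (T y) = dist x y := by
  simpa [Atomic.eval, Term.eval] using hT 2 (.dist (.var 0) (.var 1)) ![x, y]

theorem IsEmbedding.injective {T : E → F} (hT : IsEmbedding T) : Function.Injective T :=
  (Isometry.of_dist_eq hT.dist_eq).injective

theorem IsEmbedding.distortion_eq_zero {T : E → F} (hT : IsEmbedding T) : distortion T = 0 := by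
  simp only [distortion, hT _ _ _, sub_self, abs_zero, ENNReal.ofReal_zero, ENNReal.iSup_zero]

theorem IsEmbedding.distortion_comp {S : F → G} (hS : IsEmbedding S) (T : E → F) :
    distortion (S ∘ T) = distortion T := by
  refine iSup_congr fun n => iSup_congr fun φ => iSup_congr fun a => ?_
  rw [← hS n φ fun i => T (a i)]
  rfl

theorem distortion_le_distortion_comp {S : F → G} {T : E → F} (hS : IsMorphism S)
    (hT : IsMorphism T) : distortion T ≤ distortion (S ∘ T) := by
  refine iSup_mono fun n => iSup_mono fun φ => iSup_mono fun a => ENNReal.ofReal_le_ofReal ?_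
  rw [abs_of_nonneg (sub_nonneg.2 (hT n φ a))]
  exact (sub_le_sub_left (hS n φ fun i => T (a i)) _).trans (le_abs_self _)

theorem abs_eval_sub_eval_le {T : E → F} {δ : ℝ≥0} (h : distortion T ≤ δ) {n : ℕ}
    (φ : Atomic L (Fin n)) (a : Fin n → E) :
    |φ.eval E a - φ.eval F fun i => T (a i)| ≤ δ := by
  have hle : ENNReal.ofReal |φ.eval E a - φ.eval F fun i => T (a i)| ≤ distortion T :=
    le_iSup_of_le n (le_iSup_of_le φ (le_iSup_of_le a le_rfl))
  replace hle := hle.trans h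
  rwa [← ENNReal.ofReal_coe_nnreal, ENNReal.ofReal_le_ofReal_iff δ.coe_nonneg] at hle

theorem dist_le_of_unifDist_le {S T : E → F} {c : ℝ≥0} (h : unifDist S T ≤ c) (x : E) :
    dist (S x) (T x) ≤ c := by
  have hle : edist (S x) (T x) ≤ c := (le_iSup (fun x => edist (S x) (T x)) x).trans h
  rwa [edist_le_coe, ← NNReal.coe_le_coe] at hle

theorem exists_isMorphism_of_ghDist_lt {ε : ℝ≥0} (h : ghDist E F < ε) :
    ∃ (f : E → F) (g : F → E), IsMorphism f ∧ IsMorphism g ∧ (∀ x, dist (g (f x)) x ≤ ε) ∧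
      distortion f < ε := by
  obtain ⟨ε', ⟨-, f, g, hf, hg, hgf, -, hfε, -⟩, hε⟩ := sInf_lt_iff.1 h
  exact ⟨f, g, hf, hg, dist_le_of_unifDist_le (hgf.trans hε).le, hfε.trans hε⟩

end Morphism

/-! ### Limits of maps between structures -/

section Limit

variable {X Y : Str.{v, u} L}

theorem Str.continuous_fn (X : Str.{v, u} L) (f : L.Fn) : Continuous (X.fn f) :=
  continuous_of_nndist_le_modulus (L.fnMod_zero f) (L.fnMod_cont f) (X.fn_mod f)

theorem Str.continuous_rel (X : Str.{v, u} L) (R : L.Rel) : Continuous (X.rel R) :=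
  continuous_of_nndist_le_modulus (L.relMod_zero R) (L.relMod_cont R) (X.rel_mod R)

theorem Term.continuous_eval {α : Type w} (X : Str.{v, u} L) (t : Term L α) :
    Continuous fun a : α → X => t.eval X a := by
  induction t with
  | var i => exact continuous_apply i
  | app f ts ih => exact (X.continuous_fn f).comp (continuous_pi ih)

theorem Atomic.continuous_eval {α : Type w} (X : Str.{v, u} L) (φ : Atomic L α) :
    Continuous fun a : α → X => φ.eval X a := by
  cases φ with
  | dist s t => exact (s.continuous_eval X).dist (t.continuous_eval X)
  | rel R ts => exact (X.continuous_rel R).comp (continuous_pi fun k => (ts k).continuous_eval X)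

theorem exists_isMorphism_tendsto {f : ℕ → X → Y} (hf : ∀ N, IsMorphism (f N)) {D : ℕ → Set X}
    (hmono : Monotone D) (hdense : Dense (⋃ N, D N)) {C : ℝ}
    (hstep : ∀ N, ∀ x ∈ D N, dist (f N x) (f (N + 1) x) ≤ C / 2 / 2 ^ N) :
    ∃ G : X → Y, IsMorphism G ∧ ∀ x, Tendsto (fun N => f N x) atTop (𝓝 (G x)) := by
  have hcauchy : ∀ x ∈ ⋃ N, D N, CauchySeq fun N => f N x := fun x hx => by
    obtain ⟨N₀, hx⟩ := mem_iUnion.1 hx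
    exact cauchySeq_of_eventually_le_geometric_two fun N hN => hstep N x (hmono hN hx)
  choose G hG using fun x => cauchySeq_tendsto_of_complete
    (cauchySeq_apply_of_dense (fun N => (hf N).lipschitzWith) hdense hcauchy x)
  refine ⟨G, fun n φ a => ?_, hG⟩
  have hlim : Tendsto (fun N => φ.eval Y fun k => f N (a k)) atTop
      (𝓝 (φ.eval Y fun k => G (a k))) :=
    ((φ.continuous_eval Y).tendsto _).comp (tendsto_pi_nhds.2 fun k => hG (a k))
  exact le_of_tendsto' hlim fun N => hf N n φ a

theorem exists_isEmbedding_of_dense {D : Set X} (hD : Dense D) {m : D → Y}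
    (hm : ∀ (n : ℕ) (φ : Atomic L (Fin n)) (a : Fin n → D),
      φ.eval Y (fun k => m (a k)) = φ.eval X fun k => a k) :
    ∃ G : X → Y, IsEmbedding G ∧ ∀ x : D, G x = m x := by
  have hisom : Isometry m := Isometry.of_dist_eq fun x y => by
    simpa [Atomic.eval, Term.eval, Subtype.dist_eq] using hm 2 (.dist (.var 0) (.var 1)) ![x, y]
  have hval : IsUniformInducing (Subtype.val : D → X) := isUniformInducing_val D
  obtain ⟨G, hG, hGm⟩ : ∃ G : X → Y, Continuous G ∧ ∀ x : D, G x = m x :=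
    ⟨_, (uniformContinuous_uniformly_extend hval hD.denseRange_val
      hisom.uniformContinuous).continuous,
      uniformly_extend_of_ind hval hD.denseRange_val hisom.uniformContinuous⟩
  refine ⟨G, fun n φ => congrFun (Continuous.ext_on (f := fun a => φ.eval Y fun k => G (a k))
    (dense_pi univ fun _ _ => hD) ?_ (φ.continuous_eval X) ?_), hGm⟩
  · exact (φ.continuous_eval Y).comp (continuous_pi fun k => hG.comp (continuous_apply k))
  · intro b hb
    simpa only [← hGm] using hm n φ fun k => ⟨b k, hb k (mem_univ k)⟩

theorem exists_isEmbedding_of_tendsto {D : ℕ → Set X} (hmono : Monotone D)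
    (hdense : Dense (⋃ N, D N)) {δ : ℕ → ℝ} (hδ : Tendsto δ atTop (𝓝 0)) {C : ℝ}
    {g : ℕ → X → Y}
    (heval : ∀ (N n : ℕ) (φ : Atomic L (Fin n)) (a : Fin n → X), (∀ k, a k ∈ D N) →
      |φ.eval X a - φ.eval Y fun k => g N (a k)| ≤ δ N)
    (hstep : ∀ N, ∀ x ∈ D N, dist (g N x) (g (N + 1) x) ≤ C / 2 / 2 ^ N) :
    ∃ G : X → Y, IsEmbedding G ∧ ∀ x ∈ D 0, dist (G x) (g 0 x) ≤ C := by
  have hlim : ∀ x : ⋃ N, D N, ∃ y, Tendsto (fun N => g N x) atTop (𝓝 y) := fun x => by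
    obtain ⟨N₀, hx⟩ := mem_iUnion.1 x.2
    exact cauchySeq_tendsto_of_complete
      (cauchySeq_of_eventually_le_geometric_two fun N hN => hstep N x (hmono hN hx))
  choose m hm using hlim
  obtain ⟨G, hG, hGm⟩ := exists_isEmbedding_of_dense hdense (m := m) fun n φ a => by
    have hmem : ∀ᶠ N in atTop, ∀ k, (a k).1 ∈ D N := eventually_all.2 fun k => by
      obtain ⟨N₀, hk⟩ := mem_iUnion.1 (a k).2
      exact (eventually_ge_atTop N₀).mono fun N hN => hmono hN hk
    have htendsto_m : Tendsto (fun N => φ.eval Y fun k => g N (a k)) atTop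
        (𝓝 (φ.eval Y fun k => m (a k))) :=
      ((φ.continuous_eval Y).tendsto _).comp (tendsto_pi_nhds.2 fun k => hm (a k))
    refine tendsto_nhds_unique htendsto_m (tendsto_iff_dist_tendsto_zero.2 ?_)
    refine squeeze_zero' (.of_forall fun _ => dist_nonneg) (hmem.mono fun N hN => ?_) hδ
    rw [dist_comm]
    exact heval N n φ (fun k => a k) hN
  refine ⟨G, hG, fun x hx => ?_⟩
  rw [dist_comm, hGm ⟨x, mem_iUnion.2 ⟨0, hx⟩⟩]
  exact dist_le_of_le_geometric_two_of_tendsto₀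
    (fun N => hstep N x (hmono (Nat.zero_le N) hx)) (hm _)

end Limit

/-! ### Generated substructures -/

section Generated

variable {𝒜 : Set (Str.{v, u} L)} {E F : Str.{v, u} L} {n m : ℕ}

theorem Term.map_eval {T : E → F} (hT : ∀ f x, T (E.fn f x) = F.fn f fun i => T (x i))
    {α : Type w} (t : Term L α) (a : α → E) : T (t.eval E a) = t.eval F fun i => T (a i) := by
  induction t with
  | var i => rfl
  | app f ts ih => simp only [Term.eval, hT, ih]

theorem isEmbedding_genVal (a : Fin n → E) : IsEmbedding (genVal 𝒜 a) := by
  intro k φ b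
  have hterm : ∀ t : Term L (Fin k), genVal 𝒜 a (t.eval _ b) = t.eval E fun i => genVal 𝒜 a (b i) :=
    fun t => t.map_eval (fun _ _ => rfl) b
  cases φ <;> simp only [Atomic.eval, ← hterm] <;> rfl

theorem gen_subset_gen {a : Fin n → E} {b : Fin m → E} (h : ∀ i, a i ∈ gen 𝒜 b) :
    gen 𝒜 a ⊆ gen 𝒜 b :=
  fun _ hx F hF f g hf hg hfg => hx F hF f g hf hg fun i => h i F hF f g hf hg hfg

theorem subset_gen_of_range_eq {a : Fin n → E} {S : Set E} (h : range a = S) : S ⊆ gen 𝒜 a :=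
  h ▸ range_subset_iff.2 (mem_gen 𝒜 a)

theorem IsMorphism.map_mem_gen {T : E → F} (hT : IsMorphism T) {a : Fin n → E} {b : Fin m → F}
    (hTa : ∀ i, T (a i) ∈ gen 𝒜 b) {x : E} (hx : x ∈ gen 𝒜 a) : T x ∈ gen 𝒜 b :=
  fun G hG f g hf hg hfg => hx G hG _ _ (hf.comp hT) (hg.comp hT) fun i =>
    hTa i G hG f g hf hg hfg

theorem IsMorphism.exists_genStr_map {T : E → F} (hT : IsMorphism T) {a : Fin n → E}
    {b : Fin m → F} (hTa : ∀ i, T (a i) ∈ gen 𝒜 b) :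
    ∃ S : genStr 𝒜 a → genStr 𝒜 b, IsMorphism S ∧ genVal 𝒜 b ∘ S = T ∘ genVal 𝒜 a :=
  ⟨fun x => ⟨T x.1, hT.map_mem_gen hTa x.2⟩,
    (isEmbedding_genVal b).isMorphism_of_comp (hT.comp (isEmbedding_genVal a).isMorphism), rfl⟩

theorem fg_genStr (hE : E ∈ 𝒜) (a : Fin n → E) : FG 𝒜 (genStr 𝒜 a) :=
  ⟨E, hE, n, a, id, fun _ _ _ => rfl, Function.surjective_id⟩

theorem separableSpace_genStr [SeparableSpace E] (a : Fin n → E) :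
    SeparableSpace (genStr 𝒜 a) := by
  have := UniformSpace.secondCountable_of_separable E
  exact inferInstanceAs (SeparableSpace (gen 𝒜 a))

theorem exists_gen_exhaustion [SeparableSpace E] (a : Fin n → E) :
    ∃ (k : ℕ → ℕ) (t : ∀ N, Fin (k N) → E), (∀ i, a i ∈ gen 𝒜 (t 0)) ∧
      (∀ N i, t N i ∈ gen 𝒜 (t (N + 1))) ∧ Dense (⋃ N, gen 𝒜 (t N)) := by
  obtain ⟨S, hmono, hfin, hdense⟩ := exists_monotone_finite_dense_iUnion E
  choose k t _ ht using fun N => ((finite_range a).union (hfin N)).fin_param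
  have hgen : ∀ N, range a ∪ S N ⊆ gen 𝒜 (t N) := fun N => subset_gen_of_range_eq (ht N)
  refine ⟨k, t, fun i => hgen 0 (.inl (mem_range_self i)), fun N i => hgen (N + 1) ?_,
    hdense.mono (iUnion_mono fun N => subset_union_right.trans (hgen N))⟩
  exact union_subset_union_right _ (hmono N.le_succ) (ht N ▸ mem_range_self i)

theorem exists_isEmbedding_of_gen_exhaustion {k : ℕ → ℕ} {t : ∀ N, Fin (k N) → E}
    (ht : ∀ N i, t N i ∈ gen 𝒜 (t (N + 1))) (hdense : Dense (⋃ N, gen 𝒜 (t N))) {δ : ℕ → ℝ≥0}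
    (hδ : Tendsto δ atTop (𝓝 0)) {C : ℝ} {g : ∀ N, genStr 𝒜 (t N) → F}
    (hg : ∀ N, distortion (g N) ≤ δ N)
    (hstep : ∀ N x (hx : x ∈ gen 𝒜 (t N)) (hx' : x ∈ gen 𝒜 (t (N + 1))),
      dist (g N ⟨x, hx⟩) (g (N + 1) ⟨x, hx'⟩) ≤ C / 2 / 2 ^ N) :
    ∃ G : E → F, IsEmbedding G ∧ ∀ x : genStr 𝒜 (t 0), dist (G (genVal 𝒜 (t 0) x)) (g 0 x) ≤ C := by
  have hmono : Monotone fun N => gen 𝒜 (t N) :=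
    monotone_nat_of_le_succ fun N => gen_subset_gen (ht N)
  obtain ⟨g', hg'⟩ := exists_extend_of_dense_iUnion hdense g
  obtain ⟨G, hG, hGg⟩ := exists_isEmbedding_of_tendsto (C := C) (g := g') hmono hdense
    (NNReal.tendsto_coe.2 hδ)
    (fun N n φ a ha => by
      have hval : φ.eval E a = φ.eval (genStr 𝒜 (t N)) fun k => ⟨a k, ha k⟩ :=
        isEmbedding_genVal (t N) n φ fun k => ⟨a k, ha k⟩
      simpa only [hval, ← hg'] using abs_eval_sub_eval_le (hg N) φ fun k => ⟨a k, ha k⟩)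
    (fun N x hx => by
      have hx' := hmono N.le_succ hx
      rw [hg' N ⟨x, hx⟩, hg' (N + 1) ⟨x, hx'⟩]
      exact hstep N x hx hx')
  exact ⟨G, hG, fun x => hg' 0 x ▸ hGg x.1 x.2⟩

end Generated

/-! ### Embeddings in the Fraïssé limit -/

namespace IsFraisseLimit

variable {𝒜 : Set (Str.{v, u} L)} {ϖ : ℝ≥0 → ℝ≥0} {M : Str.{v, u} L} {n m : ℕ}

theorem exists_extension_genStr (hM : IsFraisseLimit 𝒜 ϖ M)
    (hgen : ∀ Y ∈ 𝒜, ∀ (n : ℕ) (y : Fin n → Y), genStr 𝒜 y ∈ 𝒜) {E F : Str.{v, u} L}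
    (hE : E ∈ 𝒜) (hF : F ∈ 𝒜) {T : E → F} (hT : IsMorphism T) {a : Fin n → E} {b : Fin m → F}
    (hTa : ∀ i, T (a i) ∈ gen 𝒜 b) {δ ε : ℝ≥0} (hTδ : distortion (T ∘ genVal 𝒜 a) < δ)
    {f : genStr 𝒜 a → M} (hf : IsMorphism f) (hfδ : distortion f < δ) (hε : 0 < ε) :
    ∃ g : genStr 𝒜 b → M, IsMorphism g ∧ distortion g < ε ∧
      ∀ x (hx : x ∈ gen 𝒜 a) (hTx : T x ∈ gen 𝒜 b), dist (g ⟨T x, hTx⟩) (f ⟨x, hx⟩) ≤ ϖ δ := by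
  obtain ⟨S, hS, hST⟩ := hT.exists_genStr_map hTa
  have hSδ : distortion S < δ := by
    rwa [← (isEmbedding_genVal b).distortion_comp S, hST]
  obtain ⟨g, hg, hgε, hgf⟩ := hM.2.2 _ (hgen E hE n a) _ (hgen F hF m b) (fg_genStr hE a)
    (fg_genStr hF b) S f δ ε (ENNReal.coe_pos.1 (pos_of_gt hfδ)) hε hS hf hSδ hfδ
  refine ⟨g, hg, hgε, fun x hx hTx => ?_⟩
  have hSx : S ⟨x, hx⟩ = ⟨T x, hTx⟩ := Subtype.ext (congrFun hST ⟨x, hx⟩)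
  rw [← hSx]
  exact dist_le_of_unifDist_le hgf.le ⟨x, hx⟩

theorem exists_extension_of_mem_gen (hM : IsFraisseLimit 𝒜 ϖ M)
    (hgen : ∀ Y ∈ 𝒜, ∀ (n : ℕ) (y : Fin n → Y), genStr 𝒜 y ∈ 𝒜) {B : Str.{v, u} L}
    (hB : B ∈ 𝒜) {a : Fin n → B} {b : Fin m → B} (hab : ∀ i, a i ∈ gen 𝒜 b) {δ ε : ℝ≥0}
    {f : genStr 𝒜 a → M} (hf : IsMorphism f) (hfδ : distortion f < δ) (hε : 0 < ε) :
    ∃ g : genStr 𝒜 b → M, (IsMorphism g ∧ distortion g < ε) ∧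
      ∀ x (hx : x ∈ gen 𝒜 a) (hx' : x ∈ gen 𝒜 b), dist (f ⟨x, hx⟩) (g ⟨x, hx'⟩) ≤ ϖ δ := by
  obtain ⟨g, hg, hgε, hgf⟩ := hM.exists_extension_genStr hgen hB hB isMorphism_id hab
    ((isEmbedding_genVal a).distortion_eq_zero.trans_lt (pos_of_gt hfδ)) hf hfδ hε
  exact ⟨g, ⟨hg, hgε⟩, fun x hx hx' => (dist_comm _ _).trans_le (hgf x hx hx')⟩

theorem exists_isEmbedding_of_genStr (hM : IsFraisseLimit 𝒜 ϖ M) (hϖ : IsModulus ϖ)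
    (hgen : ∀ Y ∈ 𝒜, ∀ (n : ℕ) (y : Fin n → Y), genStr 𝒜 y ∈ 𝒜) {B : Str.{v, u} L}
    (hB : B ∈ 𝒜) [SeparableSpace B] {b : Fin n → B} {f : genStr 𝒜 b → M} (hf : IsMorphism f)
    {δ : ℝ≥0} (hδ : distortion f < δ) {ε : ℝ} (hε : 0 < ε) :
    ∃ G : B → M, IsEmbedding G ∧ ∀ i, dist (G (b i)) (f (genTuple 𝒜 b i)) ≤ ϖ δ + ε := by
  obtain ⟨k, t, hbt, ht, hdense⟩ := exists_gen_exhaustion (𝒜 := 𝒜) b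
  choose d hd₀ hd hϖd using fun N : ℕ => hϖ.exists_lt (show 0 < ε / 2 / 2 ^ N by positivity)
  have hdlim : Tendsto d atTop (𝓝 0) := NNReal.tendsto_coe.1 <|
    squeeze_zero (fun N => (d N).coe_nonneg) (fun N => (hd N).le)
      (tendsto_const_div_two_pow_atTop (ε / 2))
  obtain ⟨g₀, hg₀, hfg₀⟩ := hM.exists_extension_of_mem_gen hgen hB hbt hf hδ (hd₀ 0)
  obtain ⟨g, rfl, hg, hstep⟩ := exists_seq_of_forall_exists_succ
    (α := fun N => genStr 𝒜 (t N) → M) (P := fun N g => IsMorphism g ∧ distortion g < d N) g₀ hg₀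
    fun N g hg => hM.exists_extension_of_mem_gen hgen hB (ht N) hg.1 hg.2 (hd₀ (N + 1))
  obtain ⟨G, hG, hGg⟩ := exists_isEmbedding_of_gen_exhaustion (C := ε) ht hdense hdlim
    (fun N => (hg N).2.le) fun N x hx hx' => (hstep N x hx hx').trans (hϖd N).le
  refine ⟨G, hG, fun i => ?_⟩
  have hGi : dist (G (b i)) (g 0 ⟨b i, hbt i⟩) ≤ ε := hGg ⟨b i, hbt i⟩
  have hfi : dist (f (genTuple 𝒜 b i)) (g 0 ⟨b i, hbt i⟩) ≤ ϖ δ := hfg₀ _ (mem_gen 𝒜 b i) (hbt i)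
  linarith [dist_triangle_right (G (b i)) (f (genTuple 𝒜 b i)) (g 0 ⟨b i, hbt i⟩)]

theorem exists_isEmbedding (hM : IsFraisseLimit 𝒜 ϖ M) (hϖ : IsModulus ϖ)
    (hgen : ∀ Y ∈ 𝒜, ∀ (n : ℕ) (y : Fin n → Y), genStr 𝒜 y ∈ 𝒜) {B : Str.{v, u} L}
    (hB : B ∈ 𝒜) [SeparableSpace B] {e : Fin n → M} {T : M → B} (hT : IsMorphism T) {δ : ℝ≥0}
    (hδ : distortion (T ∘ genVal 𝒜 e) < δ) {ε : ℝ} (hε : 0 < ε) :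
    ∃ G : B → M, IsEmbedding G ∧ ∀ i, dist (G (T (e i))) (e i) ≤ ϖ δ + ε := by
  obtain ⟨δ', hδ'₀, -, hϖδ'⟩ := hϖ.exists_lt (half_pos hε)
  have hTe : ∀ i, T (e i) ∈ gen 𝒜 (T ∘ e) := mem_gen 𝒜 (T ∘ e)
  have hval := isEmbedding_genVal (𝒜 := 𝒜) e
  obtain ⟨f, hf, hfδ', hfe⟩ := hM.exists_extension_genStr hgen hM.1 hB hT hTe hδ
    hval.isMorphism (hval.distortion_eq_zero.trans_lt (pos_of_gt hδ)) hδ'₀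
  obtain ⟨G, hG, hGf⟩ := hM.exists_isEmbedding_of_genStr hϖ hgen hB hf hfδ' (half_pos hε)
  refine ⟨G, hG, fun i => ?_⟩
  have hfi : dist (f (genTuple 𝒜 (T ∘ e) i)) (e i) ≤ ϖ δ := hfe _ (mem_gen 𝒜 e i) (hTe i)
  have hGi : dist (G (T (e i))) (f (genTuple 𝒜 (T ∘ e) i)) ≤ ϖ δ' + ε / 2 := hGf i
  linarith [dist_triangle (G (T (e i))) (f (genTuple 𝒜 (T ∘ e) i)) (e i)]

end IsFraisseLimit

/-! ### Products and retracts -/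

/-- `P` is a product of `A` and `C` as far as morphisms from the members of `𝒦` are concerned, and
such morphisms to `P` are compared through the maximum metric. Uniqueness of the lifts is not a
separate field: it is a consequence of `dist_le`. -/
structure IsMaxProduct (𝒦 : Set (Str.{v, u} L)) {A C P : Str.{v, u} L} (fst : P → A)
    (snd : P → C) : Prop where
  isMorphism_fst : IsMorphism fst
  isMorphism_snd : IsMorphism snd
  exists_lift : ∀ Z ∈ 𝒦, ∀ (f : Z → A) (g : Z → C), IsMorphism f → IsMorphism g →
    ∃ h : Z → P, IsMorphism h ∧ (∀ z, fst (h z) = f z) ∧ ∀ z, snd (h z) = g z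
  dist_le : ∀ Z ∈ 𝒦, ∀ f g : Z → P, IsMorphism f → IsMorphism g → ∀ z,
    dist (f z) (g z) ≤ max (dist (fst (f z)) (fst (g z))) (dist (snd (f z)) (snd (g z)))

namespace IsMaxProduct

variable {𝒦 𝒦' : Set (Str.{v, u} L)} {A C P : Str.{v, u} L} {fst : P → A} {snd : P → C}

theorem mono (h : IsMaxProduct 𝒦 fst snd) (hle : 𝒦' ⊆ 𝒦) : IsMaxProduct 𝒦' fst snd where
  isMorphism_fst := h.isMorphism_fst
  isMorphism_snd := h.isMorphism_snd
  exists_lift Z hZ := h.exists_lift Z (hle hZ)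
  dist_le Z hZ := h.dist_le Z (hle hZ)

theorem exists_graphs (hP : IsMaxProduct {A, C} fst snd) {f : A → C} (hf : IsMorphism f)
    {g : C → A} (hg : IsMorphism g) :
    ∃ (k : A → P) (l : C → P), IsMorphism k ∧ IsMorphism l ∧
      (∀ a, fst (k a) = a) ∧ (∀ a, snd (k a) = f a) ∧ (∀ c, snd (l c) = c) ∧
      ∀ c, dist (l c) (k (g c)) ≤ dist c (f (g c)) := by
  obtain ⟨k, hk, hk₁, hk₂⟩ := hP.exists_lift A (mem_insert A {C}) id f isMorphism_id hf
  have hC : C ∈ ({A, C} : Set (Str.{v, u} L)) := mem_insert_of_mem A rfl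
  obtain ⟨l, hl, hl₁, hl₂⟩ := hP.exists_lift C hC g id hg isMorphism_id
  refine ⟨k, l, hk, hl, hk₁, hk₂, hl₂, fun c => ?_⟩
  simpa [hk₁, hk₂, hl₁, hl₂] using hP.dist_le C hC l (k ∘ g) hl (hk.comp hg) c

end IsMaxProduct

/-- `X` is a retract of `M` in the category of structures and morphisms. -/
def IsRetract (X M : Str.{v, u} L) : Prop :=
  ∃ (η : X → M) (τ : M → X), IsMorphism η ∧ IsMorphism τ ∧ Function.LeftInverse τ η

theorem isRetract_iff_exists_idempotent {X M : Str.{v, u} L} :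
    IsRetract X M ↔ ∃ (η : X → M) (π : M → M), IsEmbedding η ∧ IsMorphism π ∧ π ∘ π = π ∧
      range η = range π := by
  constructor
  · rintro ⟨η, τ, hη, hτ, hτη⟩
    refine ⟨η, η ∘ τ, hη.isEmbedding_of_leftInverse hτ hτη, hη.comp hτ, ?_,
      (hτη.surjective.range_comp η).symm⟩
    exact funext fun m => congrArg η (hτη (τ m))
  · rintro ⟨η, π, hη, hπ, hππ, hrange⟩
    choose τ hτ using fun m => hrange.symm ▸ mem_range_self (f := π) m
    refine ⟨η, τ, hη.isMorphism, hη.isMorphism_of_comp ?_, fun x => hη.injective ?_⟩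
    · rwa [show η ∘ τ = π from funext hτ]
    · obtain ⟨m, hm⟩ := hrange ▸ mem_range_self (f := η) x
      rw [hτ, ← hm]
      exact congrFun hππ m

theorem isRetract_of_forall_exists_refinement {X M : Str.{v, u} L} [SeparableSpace X]
    [SeparableSpace M] {j₀ : X → M} {r₀ : M → X} (hj₀ : IsMorphism j₀) (hr₀ : IsMorphism r₀)
    (hrefine : ∀ (j : X → M) (r : M → X), IsMorphism j → IsMorphism r →
      ∀ (S S' : Set X) (U : Set M), S.Finite → S'.Finite → U.Finite → ∀ δ ε : ℝ, 0 < ε →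
      (∀ x ∈ S, dist (r (j x)) x ≤ δ) →
      ∃ (j' : X → M) (r' : M → X), (IsMorphism j' ∧ IsMorphism r' ∧
        ∀ x ∈ S', dist (r' (j' x)) x ≤ ε) ∧
        (∀ x ∈ S, dist (j x) (j' x) ≤ δ + ε) ∧ ∀ u ∈ U, dist (r u) (r' u) ≤ ε) :
    IsRetract X M := by
  obtain ⟨S, hSmono, hSfin, hSdense⟩ := exists_monotone_finite_dense_iUnion X
  obtain ⟨U, hUmono, hUfin, hUdense⟩ := exists_monotone_finite_dense_iUnion M
  obtain ⟨j₁, r₁, hstart, -⟩ := hrefine j₀ r₀ hj₀ hr₀ ∅ (S 0) ∅ finite_empty (hSfin 0)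
    finite_empty 0 (1 / 2 ^ 0) (by norm_num) (by simp)
  obtain ⟨f, -, hf, hstep⟩ := exists_seq_of_forall_exists_succ (α := fun _ => (X → M) × (M → X))
    (P := fun N f => IsMorphism f.1 ∧ IsMorphism f.2 ∧
      ∀ x ∈ S N, dist (f.2 (f.1 x)) x ≤ 1 / 2 ^ N)
    (R := fun N f f' => (∀ x ∈ S N, dist (f.1 x) (f'.1 x) ≤ 4 / 2 / 2 ^ N) ∧
      ∀ u ∈ U N, dist (f.2 u) (f'.2 u) ≤ 4 / 2 / 2 ^ N) (j₁, r₁) hstart fun N f hf => by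
    obtain ⟨j', r', hjr', hj', hr'⟩ := hrefine f.1 f.2 hf.1 hf.2.1 (S N) (S (N + 1)) (U N)
      (hSfin N) (hSfin _) (hUfin N) (1 / 2 ^ N) (1 / 2 ^ (N + 1)) (by positivity) hf.2.2
    have hpow : (1 : ℝ) / 2 ^ N + 1 / 2 ^ (N + 1) ≤ 4 / 2 / 2 ^ N := by
      rw [pow_succ]
      field_simp
      norm_num
    exact ⟨(j', r'), hjr', fun x hx => (hj' x hx).trans hpow,
      fun u hu => (hr' u hu).trans ((le_add_of_nonneg_left (by positivity)).trans hpow)⟩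
  obtain ⟨J, hJ, hjJ⟩ := exists_isMorphism_tendsto (fun N => (hf N).1) hSmono hSdense
    fun N => (hstep N).1
  obtain ⟨R, hR, hrR⟩ := exists_isMorphism_tendsto (fun N => (hf N).2.1) hUmono hUdense
    fun N => (hstep N).2
  refine ⟨J, R, hJ, hR, congrFun <| Continuous.ext_on hSdense (hR.comp hJ).continuous
    continuous_id fun x hx => ?_⟩
  have htendsto : Tendsto (fun N => (f N).2 ((f N).1 x)) atTop (𝓝 (R (J x))) :=
    tendsto_apply_of_lipschitzWith_one (fun N => (hf N).2.1.lipschitzWith) (hjJ x) (hrR (J x))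
  refine tendsto_nhds_unique htendsto (tendsto_iff_dist_tendsto_zero.2 ?_)
  obtain ⟨N₀, hx⟩ := mem_iUnion.1 hx
  exact squeeze_zero' (.of_forall fun _ => dist_nonneg)
    ((eventually_ge_atTop N₀).mono fun N hN => (hf N).2.2 x (hSmono hN hx))
    (tendsto_const_div_two_pow_atTop 1)

/-- The identity of `X` is a pointwise limit of morphisms that factor through members of `𝒥`. -/
def ApproxFactorsThrough (𝒥 : Set (Str.{v, u} L)) (X : Str.{v, u} L) : Prop :=
  ∀ S : Set X, S.Finite → ∀ ε : ℝ, 0 < ε → ∃ A ∈ 𝒥, ∃ (p : X → A) (s : A → X),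
    IsMorphism p ∧ IsMorphism s ∧ ∀ x ∈ S, dist (s (p x)) x ≤ ε

theorem IsRetract.approxFactorsThrough {𝒥 : Set (Str.{v, u} L)} {X M : Str.{v, u} L}
    (h : IsRetract X M) (hM : ApproxFactorsThrough 𝒥 M) : ApproxFactorsThrough 𝒥 X := by
  obtain ⟨η, τ, hη, hτ, hτη⟩ := h
  intro S hS ε hε
  obtain ⟨A, hA, p, s, hp, hs, hsp⟩ := hM (η '' S) (hS.image η) ε hε
  refine ⟨A, hA, p ∘ η, τ ∘ s, hp.comp hη, hτ.comp hs, fun x hx => ?_⟩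
  simpa only [Function.comp_apply, hτη x] using
    (hτ.dist_le _ _).trans (hsp (η x) (mem_image_of_mem η hx))

/-! ### Classes generated by injective structures -/

/-- A hereditary class `𝒜` with enough injectives from `𝒥`, with modulus `ϖ`, where any two members
of `𝒥` are connected by morphisms and have a product in `𝒥`. The product is only tested on morphisms
from its two factors, which in a stratified class are the ones sure to share a stratum with it. -/
structure IsInjectivelyGenerated (𝒜 𝒥 : Set (Str.{v, u} L)) (ϖ : ℝ≥0 → ℝ≥0) : Prop where
  modulus : IsModulus ϖ
  genStr_mem : ∀ Y ∈ 𝒜, ∀ (n : ℕ) (y : Fin n → Y), genStr 𝒜 y ∈ 𝒜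
  subset : 𝒥 ⊆ 𝒜
  separable : ∀ A ∈ 𝒥, SeparableSpace A
  enough : EnoughInjectives 𝒜 𝒜 𝒥 ϖ
  exists_isMorphism : ∀ A ∈ 𝒥, ∀ C ∈ 𝒥, ∃ f : A → C, IsMorphism f
  exists_product : ∀ A ∈ 𝒥, ∀ C ∈ 𝒥, ∃ P ∈ 𝒥, ∃ (fst : P → A) (snd : P → C),
    IsMaxProduct {A, C} fst snd

namespace IsInjectivelyGenerated

variable {𝒜 𝒥 ℐ : Set (Str.{v, u} L)} {ϖ : ℝ≥0 → ℝ≥0} {M X Y Z A C : Str.{v, u} L} {n : ℕ}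

theorem exists_extension (H : IsInjectivelyGenerated 𝒜 𝒥 ϖ) (hY : Y ∈ 𝒜) [SeparableSpace Y]
    (hZ : Z ∈ 𝒜) [SeparableSpace Z] (hA : A ∈ 𝒥) {y : Fin n → Y} {i : genStr 𝒜 y → Z}
    (hi : IsEmbedding i) {f : genStr 𝒜 y → A} (hf : IsMorphism f) :
    ∃ g : Z → A, IsMorphism g ∧ ∀ x, g (i x) = f x := by
  obtain ⟨g, hg, hgf⟩ := H.enough.extend _ (H.genStr_mem Y hY n y) Z hZ A hA (fg_genStr hY y)
    (separableSpace_genStr y) ‹_› (H.separable A hA) i f 0 hi.isMorphism hf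
    hi.distortion_eq_zero.le
  refine ⟨g, hg, fun x => dist_le_zero.1 ?_⟩
  simpa [H.modulus.2.1] using dist_le_of_unifDist_le hgf x

theorem exists_leftInvOn_gen (H : IsInjectivelyGenerated 𝒜 𝒥 ϖ) (hA : A ∈ 𝒥) (hZ : Z ∈ 𝒜)
    [SeparableSpace Z] {G : A → Z} (hG : IsEmbedding G) (a : Fin n → A) :
    ∃ h : Z → A, IsMorphism h ∧ LeftInvOn h G (gen 𝒜 a) := by
  have := H.separable A hA
  have hval := isEmbedding_genVal (𝒜 := 𝒜) a
  obtain ⟨h, hh, hhG⟩ := H.exists_extension (H.subset hA) hZ hA (hG.comp hval) hval.isMorphism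
  exact ⟨h, hh, fun x hx => hhG ⟨x, hx⟩⟩

theorem exists_approx_genStr (H : IsInjectivelyGenerated 𝒜 𝒥 ϖ) (hY : Y ∈ 𝒜) [SeparableSpace Y]
    (y : Fin n → Y) {ε : ℝ≥0} (hε : 0 < ε) :
    ∃ A ∈ 𝒥, ∃ (m : ℕ) (a : Fin m → A) (p : Y → A) (g : genStr 𝒜 a → Y), IsMorphism p ∧
      IsMorphism g ∧ distortion (p ∘ genVal 𝒜 y) < ε ∧
      ∀ i, ∃ hi : p (y i) ∈ gen 𝒜 a, dist (g ⟨p (y i), hi⟩) (y i) ≤ ε := by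
  obtain ⟨A, hA, m, a, hgh⟩ := H.enough.approx _ (H.genStr_mem Y hY n y) (fg_genStr hY y) ε
    (ENNReal.coe_pos.2 hε)
  obtain ⟨f, g, hf, hg, hgf, hfε⟩ := exists_isMorphism_of_ghDist_lt hgh
  have hval := isEmbedding_genVal (𝒜 := 𝒜) a
  obtain ⟨p, hp, hpf⟩ := H.exists_extension hY hY hA (isEmbedding_genVal y)
    (hval.isMorphism.comp hf)
  refine ⟨A, hA, m, a, p, genVal 𝒜 y ∘ g, hp, (isEmbedding_genVal y).isMorphism.comp hg, ?_,
    fun i => ?_⟩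
  · rwa [show p ∘ genVal 𝒜 y = genVal 𝒜 a ∘ f from funext hpf, hval.distortion_comp]
  · have hpi : p (y i) = genVal 𝒜 a (f (genTuple 𝒜 y i)) := hpf (genTuple 𝒜 y i)
    refine ⟨hpi ▸ (f (genTuple 𝒜 y i)).2, ?_⟩
    simp only [hpi]
    exact hgf (genTuple 𝒜 y i)

theorem exists_factor_limit (H : IsInjectivelyGenerated 𝒜 𝒥 ϖ) (hM : IsFraisseLimit 𝒜 ϖ M)
    (e : Fin n → M) {δ : ℝ≥0} (hδ : 0 < δ) {ε : ℝ} (hε : 0 < ε) :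
    ∃ A ∈ 𝒥, ∃ (p : M → A) (s : A → M), IsMorphism p ∧ IsMorphism s ∧
      distortion (p ∘ genVal 𝒜 e) < δ ∧ ∀ i, dist (s (p (e i))) (e i) ≤ ϖ δ + ε := by
  have := hM.2.1
  obtain ⟨A, hA, -, -, p, -, hp, -, hpδ, -⟩ := H.exists_approx_genStr hM.1 e hδ
  have := H.separable A hA
  obtain ⟨s, hs, hsp⟩ := hM.exists_isEmbedding H.modulus H.genStr_mem (H.subset hA) hp hpδ hε
  exact ⟨A, hA, p, s, hp, hs.isMorphism, hpδ, hsp⟩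

theorem approxFactorsThrough_limit (H : IsInjectivelyGenerated 𝒜 𝒥 ϖ)
    (hM : IsFraisseLimit 𝒜 ϖ M) : ApproxFactorsThrough 𝒥 M := by
  intro S hS ε hε
  obtain ⟨n, e, -, he⟩ := hS.fin_param
  obtain ⟨δ, hδ₀, -, hϖδ⟩ := H.modulus.exists_lt (half_pos hε)
  obtain ⟨A, hA, p, s, hp, hs, -, hsp⟩ := H.exists_factor_limit hM e hδ₀ (half_pos hε)
  refine ⟨A, hA, p, s, hp, hs, he ▸ forall_mem_range.2 fun i => ?_⟩
  linarith [hsp i]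

theorem isApproxInjective_of_approxFactorsThrough (H : IsInjectivelyGenerated 𝒜 𝒥 ϖ)
    (hℐ : ℐ ⊆ 𝒜) (hℐsep : ∀ A ∈ ℐ, SeparableSpace A) (hX : ApproxFactorsThrough 𝒥 X) :
    IsApproxInjective 𝒜 ℐ X := by
  intro A hA n a f hf ε hε
  obtain ⟨B, hB, p, s, hp, hs, hsp⟩ := hX (range (f ∘ genTuple 𝒜 a)) (finite_range _) ε hε
  have := hℐsep A hA
  obtain ⟨k, hk, hkf⟩ := H.exists_extension (hℐ hA) (hℐ hA) hB (isEmbedding_genVal a) (hp.comp hf)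
  refine ⟨s ∘ k, hs.comp hk, (dist_pi_le_iff hε.le).2 fun i => ?_⟩
  have hki : k (a i) = p (f (genTuple 𝒜 a i)) := hkf (genTuple 𝒜 a i)
  simpa only [Function.comp_apply, hki] using hsp _ (mem_range_self i)

theorem exists_approx_extension (H : IsInjectivelyGenerated 𝒜 𝒥 ϖ) (hℐ : ℐ ⊆ 𝒜)
    (hℐsep : ∀ A ∈ ℐ, SeparableSpace A) (hcofinal : ∀ B ∈ 𝒥, ∃ A ∈ ℐ, ∃ i : B → A, IsEmbedding i)
    (hX : IsApproxInjective 𝒜 ℐ X) (hA : A ∈ 𝒥) {m : ℕ} {a : Fin m → A} {g : genStr 𝒜 a → X}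
    (hg : IsMorphism g) {w : Fin n → A} (hw : ∀ k, w k ∈ gen 𝒜 a) {ε : ℝ} (hε : 0 < ε) :
    ∃ s : A → X, IsMorphism s ∧ ∀ k, dist (s (w k)) (g ⟨w k, hw k⟩) ≤ ε := by
  obtain ⟨B, hB, i, hi⟩ := hcofinal A hA
  have := hℐsep B hB
  obtain ⟨r, hr, hri⟩ := H.exists_leftInvOn_gen hA (hℐ hB) hi a
  have hriw : ∀ k, r ((i ∘ w) k) = w k := fun k => hri (hw k)
  obtain ⟨R, hR, hRr⟩ := hr.exists_genStr_map fun k => (hriw k).symm ▸ hw k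
  obtain ⟨s, hs, hsg⟩ := hX B hB n (i ∘ w) (g ∘ R) (hg.comp hR) ε hε
  refine ⟨s ∘ i, hs.comp hi.isMorphism, fun k => ?_⟩
  have hRk : R (genTuple 𝒜 (i ∘ w) k) = ⟨w k, hw k⟩ :=
    Subtype.ext ((congrFun hRr _).trans (hriw k))
  simpa only [Function.comp_apply, hRk] using (dist_le_pi_dist _ _ k).trans hsg

theorem approxFactorsThrough_of_isApproxInjective (H : IsInjectivelyGenerated 𝒜 𝒥 ϖ) (hℐ : ℐ ⊆ 𝒜)
    (hℐsep : ∀ A ∈ ℐ, SeparableSpace A) (hcofinal : ∀ B ∈ 𝒥, ∃ A ∈ ℐ, ∃ i : B → A, IsEmbedding i)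
    (hXA : X ∈ 𝒜) [SeparableSpace X] (hX : IsApproxInjective 𝒜 ℐ X) :
    ApproxFactorsThrough 𝒥 X := by
  intro S hS ε hε
  obtain ⟨n, x, -, hx⟩ := hS.fin_param
  lift ε to ℝ≥0 using hε.le
  obtain ⟨A, hA, m, a, p, g, hp, hg, -, hgp⟩ := H.exists_approx_genStr hXA x
    (half_pos (NNReal.coe_pos.1 hε))
  choose hmem hgx using hgp
  obtain ⟨s, hs, hsg⟩ := H.exists_approx_extension hℐ hℐsep hcofinal hX hA hg hmem (half_pos hε)
  refine ⟨A, hA, p, s, hp, hs, hx ▸ forall_mem_range.2 fun i => ?_⟩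
  calc dist (s (p (x i))) (x i)
      ≤ dist (s (p (x i))) (g ⟨p (x i), hmem i⟩) + dist (g ⟨p (x i), hmem i⟩) (x i) :=
        dist_triangle ..
    _ ≤ ε / 2 + ε / 2 := add_le_add (hsg i) (hgx i)
    _ = ε := add_halves _

theorem exists_graph_splitting (H : IsInjectivelyGenerated 𝒜 𝒥 ϖ) (hM : IsFraisseLimit 𝒜 ϖ M)
    (hA : A ∈ 𝒥) (hC : C ∈ 𝒥) {p : M → A} (hp : IsMorphism p) {f : A → C} (hf : IsMorphism f)
    {g : C → A} (hg : IsMorphism g) {e : Fin n → M} {δ : ℝ≥0}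
    (hpδ : distortion (p ∘ genVal 𝒜 e) < δ) {V : Set C} (hV : V.Finite) {ε : ℝ} (hε : 0 < ε) :
    ∃ (k : C → M) (q : M → C), IsMorphism k ∧ IsMorphism q ∧ LeftInvOn q k V ∧
      (∀ c i, dist (k c) (e i) ≤ dist c (f (g c)) + dist (g c) (p (e i)) + (ϖ δ + ε)) ∧
      ∀ i, dist (q (e i)) (f (p (e i))) ≤ ϖ δ + ε := by
  obtain ⟨P, hP, fst, snd, hprod⟩ := H.exists_product A hA C hC
  have := H.separable P hP
  have := hM.2.1
  obtain ⟨l, k, hl, hk, hfstl, hsndl, hsndk, hkl⟩ := hprod.exists_graphs hf hg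
  have hlpδ : distortion ((l ∘ p) ∘ genVal 𝒜 e) < δ := by
    refine (distortion_le_distortion_comp hprod.isMorphism_fst
      ((hl.comp hp).comp (isEmbedding_genVal e).isMorphism)).trans_lt ?_
    rwa [show fst ∘ (l ∘ p) ∘ genVal 𝒜 e = p ∘ genVal 𝒜 e from funext fun _ => hfstl _]
  obtain ⟨G, hG, hGe⟩ := hM.exists_isEmbedding H.modulus H.genStr_mem (H.subset hP) (hl.comp hp)
    hlpδ hε
  obtain ⟨m, w, -, hw⟩ := ((hV.image k).union (finite_range (l ∘ p ∘ e))).fin_param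
  obtain ⟨h, hh, hhG⟩ := H.exists_leftInvOn_gen hP hM.1 hG w
  replace hhG := hhG.mono (subset_gen_of_range_eq hw)
  refine ⟨G ∘ k, snd ∘ h, hG.isMorphism.comp hk, hprod.isMorphism_snd.comp hh, fun c hc => ?_,
    fun c i => ?_, fun i => ?_⟩
  · exact (congrArg snd (hhG (.inl (mem_image_of_mem k hc)))).trans (hsndk c)
  · have hle : dist (G (k c)) (G (l (p (e i)))) ≤ dist c (f (g c)) + dist (g c) (p (e i)) := by
      rw [hG.dist_eq]
      exact (dist_triangle _ (l (g c)) _).trans (add_le_add (hkl c) (hl.dist_le _ _))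
    exact (dist_triangle _ (G (l (p (e i)))) _).trans (add_le_add hle (hGe i))
  · have hsnd : f (p (e i)) = snd (h (G (l (p (e i))))) :=
      (hsndl _).symm.trans (congrArg snd (hhG (.inr (mem_range_self i))).symm)
    rw [hsnd, dist_comm]
    exact ((hprod.isMorphism_snd.comp hh).dist_le _ _).trans (hGe i)

theorem exists_refinement (H : IsInjectivelyGenerated 𝒜 𝒥 ϖ) (hM : IsFraisseLimit 𝒜 ϖ M)
    (hX : ApproxFactorsThrough 𝒥 X) {j : X → M} {r : M → X} (hj : IsMorphism j)
    (hr : IsMorphism r) {S S' : Set X} {U : Set M} (hS : S.Finite) (hS' : S'.Finite)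
    (hU : U.Finite) {δ ε : ℝ} (hε : 0 < ε) (hrj : ∀ x ∈ S, dist (r (j x)) x ≤ δ) :
    ∃ (j' : X → M) (r' : M → X), (IsMorphism j' ∧ IsMorphism r' ∧
      ∀ x ∈ S', dist (r' (j' x)) x ≤ ε) ∧
      (∀ x ∈ S, dist (j x) (j' x) ≤ δ + ε) ∧ ∀ u ∈ U, dist (r u) (r' u) ≤ ε := by
  obtain ⟨n, e, -, he⟩ := (hU.union (hS.image j)).fin_param
  obtain ⟨δ₀, hδ₀, -, hϖδ₀⟩ := H.modulus.exists_lt (show 0 < ε / 8 by positivity)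
  obtain ⟨A, hA, p, s, hp, hs, hpδ₀, hsp⟩ := H.exists_factor_limit hM e hδ₀
    (show 0 < ε / 8 by positivity)
  obtain ⟨C, hC, t, b, ht, hb, hbt⟩ := hX (S ∪ S' ∪ r '' U) ((hS.union hS').union (hU.image r))
    (ε / 4) (by positivity)
  obtain ⟨k, q, hk, hq, hqk, hke, hqe⟩ := H.exists_graph_splitting hM hA hC hp
    (ht.comp (hr.comp hs)) (hp.comp (hj.comp hb)) hpδ₀ (hS'.image t) (show 0 < ε / 8 by positivity)
  refine ⟨k ∘ t, b ∘ q, ⟨hk.comp ht, hb.comp hq, fun x hx => ?_⟩, fun x hx => ?_, fun u hu => ?_⟩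
  · have hqkt : q (k (t x)) = t x := hqk (mem_image_of_mem t hx)
    simp only [Function.comp_apply, hqkt]
    linarith [hbt x (.inl (.inr hx))]
  · obtain ⟨i, hi⟩ : j x ∈ range e := he ▸ .inr (mem_image_of_mem j hx)
    have hbtx : dist (b (t x)) x ≤ ε / 4 := hbt x (.inl (.inl hx))
    have hround : dist (t x) (t (r (s (p (j (b (t x))))))) ≤ δ + ε / 2 := by
      have hsp_b : dist (r (s (p (j (b (t x)))))) (r (s (p (j x)))) ≤ ε / 4 :=
        ((hr.comp (hs.comp (hp.comp hj))).dist_le _ _).trans hbtx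
      have hsp_j : dist (r (s (p (j x)))) (r (j x)) ≤ ε / 4 := by
        rw [← hi]
        exact (hr.dist_le _ _).trans ((hsp i).trans (by linarith))
      rw [dist_comm]
      linarith [ht.dist_le (r (s (p (j (b (t x)))))) x, hrj x hx,
        dist_triangle4 (r (s (p (j (b (t x)))))) (r (s (p (j x)))) (r (j x)) x]
    have hpj : dist (p (j (b (t x)))) (p (j x)) ≤ ε / 4 := ((hp.comp hj).dist_le _ _).trans hbtx
    have hkt := hke (t x) i
    simp only [Function.comp_apply, hi] at hkt
    rw [dist_comm]
    exact hkt.trans (by linarith)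
  · obtain ⟨i, rfl⟩ : u ∈ range e := he ▸ .inl hu
    have hq_f : dist (b (q (e i))) (b (t (r (s (p (e i)))))) ≤ ε / 4 :=
      (hb.dist_le _ _).trans ((hqe i).trans (by linarith))
    have hf_r : dist (b (t (r (s (p (e i)))))) (b (t (r (e i)))) ≤ ε / 4 :=
      ((hb.comp (ht.comp hr)).dist_le _ _).trans ((hsp i).trans (by linarith))
    have hr_id : dist (b (t (r (e i)))) (r (e i)) ≤ ε / 4 := hbt _ (.inr (mem_image_of_mem r hu))
    rw [dist_comm]
    exact (dist_triangle4 _ (b (t (r (s (p (e i)))))) (b (t (r (e i)))) _).trans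
      ((add_le_add_three hq_f hf_r hr_id).trans (by linarith))

theorem isRetract_limit (H : IsInjectivelyGenerated 𝒜 𝒥 ϖ) (hM : IsFraisseLimit 𝒜 ϖ M)
    [SeparableSpace X] (hX : ApproxFactorsThrough 𝒥 X) : IsRetract X M := by
  have := hM.2.1
  obtain ⟨C, hC, t, b, ht, hb, -⟩ := hX ∅ finite_empty 1 one_pos
  obtain ⟨A, hA, p, s, hp, hs, -⟩ := H.approxFactorsThrough_limit hM ∅ finite_empty 1 one_pos
  obtain ⟨f, hf⟩ := H.exists_isMorphism A hA C hC
  obtain ⟨g, hg⟩ := H.exists_isMorphism C hC A hA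
  exact isRetract_of_forall_exists_refinement (hs.comp (hg.comp ht)) (hb.comp (hf.comp hp))
    fun j r hj hr S S' U hS hS' hU δ ε hε => H.exists_refinement hM hX hj hr hS hS' hU hε

end IsInjectivelyGenerated

/-! ### Stratified classes -/

theorem FullConditions.isMaxProduct {𝒜 𝒦 : Set (Str.{v, u} L)} (H : FullConditions 𝒜 𝒦)
    {Y : Bool → Str.{v, u} L} (hY : ∀ i, Y i ∈ 𝒦) {P : Str.{v, u} L} {π : ∀ i, P → Y i}
    (hP : IsProduct 𝒦 Y P π) : IsMaxProduct 𝒦 (π false) (π true) where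
  isMorphism_fst := hP.2.1 false
  isMorphism_snd := hP.2.1 true
  exists_lift Z hZ f g hf hg := by
    obtain ⟨h, ⟨hh, hπh⟩, -⟩ := hP.2.2 Z hZ (Bool.rec f g) (Bool.rec hf hg)
    exact ⟨h, hh, hπh false, hπh true⟩
  dist_le Z hZ f g hf hg z := by
    have hfg : ∀ k, IsMorphism (![f, g] k) := Fin.forall_fin_two.2 ⟨hf, hg⟩
    simpa only [Atomic.eval, Term.eval, Matrix.cons_val_zero, Matrix.cons_val_one,
      Function.comp_apply] using
      H.product_max Y hY P π hP Z hZ 2 (fun k => π false ∘ ![f, g] k) (fun k => π true ∘ ![f, g] k)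
        ![f, g] (fun k => (hP.2.1 false).comp (hfg k)) (fun k => (hP.2.1 true).comp (hfg k)) hfg
        (fun _ _ => rfl) (fun _ _ => rfl) 1 (.dist (.var (0, 0)) (.var (1, 0))) ![z]

theorem EnoughInjectives.separableSpace_of_fg {𝒜 𝒦 𝒥 : Set (Str.{v, u} L)} {ϖ : ℝ≥0 → ℝ≥0}
    (H : EnoughInjectives 𝒜 𝒦 𝒥 ϖ) (hsep : ∀ A ∈ 𝒥, SeparableSpace A) {X : Str.{v, u} L}
    (hX : X ∈ 𝒦) (hfg : FG 𝒜 X) : SeparableSpace X := by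
  suffices SecondCountableTopology X from inferInstance
  refine Metric.secondCountable_of_almost_dense_set fun ε hε => ?_
  lift ε to ℝ≥0 using hε.le
  have hε₂ : 0 < ε / 2 := half_pos (NNReal.coe_pos.1 hε)
  obtain ⟨A, hA, m, a, hgh⟩ := H.approx X hX hfg (ε / 2 : ℝ≥0) (ENNReal.coe_pos.2 hε₂)
  obtain ⟨f, g, -, hg, hgf, -⟩ := exists_isMorphism_of_ghDist_lt hgh
  have := hsep A hA
  have := separableSpace_genStr (𝒜 := 𝒜) a
  obtain ⟨S, hS, hSdense⟩ := exists_countable_dense (genStr 𝒜 a)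
  refine ⟨g '' S, hS.image g, fun x => ?_⟩
  obtain ⟨z, hz, hxz⟩ := hSdense.exists_dist_lt (f x) (NNReal.coe_pos.2 hε₂)
  refine ⟨g z, mem_image_of_mem g hz, ?_⟩
  calc dist x (g z) ≤ dist x (g (f x)) + dist (g (f x)) (g z) := dist_triangle ..
    _ ≤ (ε / 2 : ℝ≥0) + (ε / 2 : ℝ≥0) :=
      add_le_add ((dist_comm _ _).trans_le (hgf x)) ((hg.dist_le _ _).trans hxz.le)
    _ = ε := by rw [← NNReal.coe_add, add_halves]

theorem EnoughInjectives.exists_isMorphism {𝒜 𝒦 𝒥 : Set (Str.{v, u} L)} {ϖ : ℝ≥0 → ℝ≥0}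
    (H : EnoughInjectives 𝒜 𝒦 𝒥 ϖ) (h𝒥 : 𝒥 ⊆ 𝒦) (hsep : ∀ A ∈ 𝒥, SeparableSpace A)
    {A₀ : Str.{v, u} L} (hfg : FG 𝒜 A₀) (hA₀ : IsInitialObject 𝒦 A₀) {X A : Str.{v, u} L}
    (hX : X ∈ 𝒦) [SeparableSpace X]
    (hfin : ∀ i : A₀ → X, IsMorphism i → distortion i < ⊤) (hA : A ∈ 𝒥) :
    ∃ f : X → A, IsMorphism f := by
  obtain ⟨i, hi, -⟩ := hA₀.2 X hX
  obtain ⟨k, hk, -⟩ := hA₀.2 A (h𝒥 hA)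
  obtain ⟨f, hf, -⟩ := H.extend A₀ hA₀.1 X hX A hA hfg (H.separableSpace_of_fg hsep hA₀.1 hfg) ‹_›
    (hsep A hA) i k (distortion i).toNNReal hi hk (ENNReal.coe_toNNReal (hfin i hi).ne).ge
  exact ⟨f, hf⟩

namespace IsStratifiedClass

variable {𝒜 : Set (Str.{v, u} L)} {𝒜q ℐq : ℕ → Set (Str.{v, u} L)} {ℐ : Set (Str.{v, u} L)}
  {ϖ : ℝ≥0 → ℝ≥0}

theorem exists_product (H : IsStratifiedClass 𝒜 𝒜q ℐq ℐ ϖ) {A C : Str.{v, u} L}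
    (hA : A ∈ ⋃ q, ℐq q) (hC : C ∈ ⋃ q, ℐq q) :
    ∃ P ∈ ⋃ q, ℐq q, ∃ (fst : P → A) (snd : P → C), IsMaxProduct {A, C} fst snd := by
  obtain ⟨q₁, hA⟩ := mem_iUnion.1 hA
  obtain ⟨q₂, hC⟩ := mem_iUnion.1 hC
  have hmono : Monotone ℐq := monotone_nat_of_le_succ H.inj_mono
  replace hA : A ∈ ℐq (max q₁ q₂) := hmono (le_max_left _ _) hA
  replace hC : C ∈ ℐq (max q₁ q₂) := hmono (le_max_right _ _) hC
  obtain ⟨P, hP, π, hπ⟩ := H.inj_products _ (Bool.rec A C) (Bool.rec hA hC)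
  have hA' := (H.inj_injective _ A hA).1
  have hC' := (H.inj_injective _ C hC).1
  exact ⟨P, mem_iUnion_of_mem _ hP, π false, π true,
    ((H.strata _).isMaxProduct (Bool.rec hA' hC') hπ).mono (pair_subset hA' hC')⟩

theorem isInjectivelyGenerated (H : IsStratifiedClass 𝒜 𝒜q ℐq ℐ ϖ) :
    IsInjectivelyGenerated 𝒜 (⋃ q, ℐq q) ϖ := by
  have hsubset : ⋃ q, ℐq q ⊆ 𝒜 :=
    iUnion_subset fun q A hA => H.stratum_subset q (H.inj_injective q A hA).1
  have hsep : ∀ A ∈ ⋃ q, ℐq q, SeparableSpace A := fun A hA =>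
    let ⟨q, hA⟩ := mem_iUnion.1 hA
    H.inj_separable q A hA
  obtain ⟨A₀, hfg, hA₀⟩ := H.base.initial
  exact {
    modulus := H.modulus
    genStr_mem := fun Y => (H.base.mem_iff Y).1
    subset := hsubset
    separable := hsep
    enough := H.enough
    exists_isMorphism := fun A hA _ hC =>
      have := hsep A hA
      H.enough.exists_isMorphism hsubset hsep hfg hA₀ (hsubset hA)
        (H.initial_finite A₀ hA₀ A (hsubset hA)) hC
    exists_product := fun _ hA _ hC => H.exists_product hA hC }

end IsStratifiedClass

end MetricFraisse

theorem theorem7p2_general {L : MetricFraisse.Language} {𝒜 𝒥 ℐ : Set (MetricFraisse.Str L)}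
    {ϖ : NNReal → NNReal} (H : MetricFraisse.IsInjectivelyGenerated 𝒜 𝒥 ϖ) (hℐ : ℐ ⊆ 𝒜)
    (hℐsep : ∀ A ∈ ℐ, TopologicalSpace.SeparableSpace A)
    (hcofinal : ∀ B ∈ 𝒥, ∃ A ∈ ℐ, ∃ i : B → A, MetricFraisse.IsEmbedding i)
    {M : MetricFraisse.Str L} (hM : MetricFraisse.IsFraisseLimit 𝒜 ϖ M)
    {X : MetricFraisse.Str L} (hX : X ∈ 𝒜) (hXsep : TopologicalSpace.SeparableSpace X) :
    MetricFraisse.IsApproxInjective 𝒜 ℐ X ↔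
      ∃ (η : X → M) (π : M → M), MetricFraisse.IsEmbedding η ∧ MetricFraisse.IsMorphism π ∧
        π ∘ π = π ∧ Set.range η = Set.range π := by
  rw [← MetricFraisse.isRetract_iff_exists_idempotent]
  constructor
  · intro h
    exact H.isRetract_limit hM
      (H.approxFactorsThrough_of_isApproxInjective hℐ hℐsep hcofinal hX h)
  · intro h
    exact H.isApproxInjective_of_approxFactorsThrough hℐ hℐsep
      (h.approxFactorsThrough (H.approxFactorsThrough_limit hM))

theorem theorem7p2 {L : MetricFraisse.Language} (𝒜 : Set (MetricFraisse.Str L))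
    (𝒜q ℐq : ℕ → Set (MetricFraisse.Str L)) (ℐ : Set (MetricFraisse.Str L)) (ϖ : NNReal → NNReal)
    (hclass : MetricFraisse.IsStratifiedClass 𝒜 𝒜q ℐq ℐ ϖ)
    (M : MetricFraisse.Str L) (hM : MetricFraisse.IsFraisseLimit 𝒜 ϖ M)
    (X : MetricFraisse.Str L) (hX : X ∈ 𝒜) (hXsep : TopologicalSpace.SeparableSpace X) :
    MetricFraisse.IsApproxInjective 𝒜 ℐ X ↔
      ∃ (η : X → M) (π : M → M), MetricFraisse.IsEmbedding η ∧ MetricFraisse.IsMorphism π ∧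
        π ∘ π = π ∧ Set.range η = Set.range π := by
  have H := hclass.isInjectivelyGenerated
  exact theorem7p2_general H (hclass.cofinal_subset.trans H.subset)
    (fun A hA => H.separable A (hclass.cofinal_subset hA)) hclass.cofinal hM hX hXsep
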